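/- **Conventions.** Fix $n\ge 1$ and the alphabet $[\pm n]=\{1<\dots<n<\overline n<\dots<\overline 1\}$, with $\overline{\overline i}=i$. A column is a strictly increasing sequence of letters, written from top to bottom and identified with its set of entries. A column $C$ is admissible if for all pairs $i,\overline i\in C$ (with $i\in[n]$) the number of $x\in C$ with $x\le i$ or $x\ge\overline i$ is at most $i$. For admissible $C$ let $I=\{z_1>\dots>z_r\}$ be the set of $z\in[n]$ with $z,\overline z\in C$, and let $J=\{t_1>\dots>t_r\}\subseteq[n]$, where $t_i$ is the greatest letter of $[n]$ with $t_i<z_i$, $t_i<t_{i-1}$ (if $i\geq 2$) and $t_i,\overline{t_i}\notin C$ (such letters exist). Then $rC$ (resp. $\ell C$) is obtained from $C$ by replacing every $\overline{z_i}$ by $\overline{t_i}$ (resp. every $z_i$ by $t_i$) and reordering, and $\Phi(C)$ is the column consisting of the unbarred entries of $\ell C$ and the barred entries of $rC$; $\Phi$ is injective on admissible columns. A straight Kashiwara–Nakashima (KN) tableau is a semistandard tableau $T=C_1\cdots C_k$ of partition shape with admissible nonempty columns such that its split form $\ell C_1\,rC_1\cdots \ell C_k\,rC_k$ is semistandard.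 **The symplectic right key by jeu de taquin.** In a two-column skew tableau with columns $C_1,C_2$, a (reverse) symplectic jeu de taquin run is the following. Put a puncture below the last cell of the second column, where this gives a skew shape. While the puncture is in the second column, let $\beta$ be the entry of $\ell C_2$ directly above it and $\alpha$ the entry of $rC_1$ directly to its left. If $\beta$ exists and either $\alpha$ does not exist or $\alpha\le\beta$, the puncture moves up one cell. If $\alpha$ exists and either $\beta$ does not exist or $\alpha>\beta$, the puncture moves left, and $(C_1,C_2)$ becomes $(C_1\setminus\{\alpha\},\ \Phi^{-1}(\Phi(C_2)\cup\{\alpha\}))$ if $\alpha$ is unbarred and $(\Phi^{-1}(\Phi(C_1)\setminus\{\alpha\}),\ C_2\cup\{\alpha\})$ if $\alpha$ is barred. If neither $\alpha$ nor $\beta$ exists, or once the puncture is in the first column, the puncture moves to the top of its column and becomes an inner cell of the skew shape. For a straight KN tableau $T=C_1\cdots C_k$ put $D_1=C_1$; for $2\le j\le k$, apply such runs to the straight two-column tableau $D_{j-1}C_j$ until the two column lengths are swapped (no run if they are equal), and let $D_j$ be the resulting rightmost column. The first column of the right key of $T$ is $K_+^1(T)=rD_k$. **The direct way.** Put $C_1'=rC_1$.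 For $j=2,\dots,k$, define $C_j'$ from $C_{j-1}'$ and $C_j$ as follows. Matching: go through the elements $\beta$ of $\ell C_j$ from the biggest to the smallest, and match $\beta$ with the biggest not yet matched element of $C_{j-1}'$ that is at most $\beta$. Filling: start with $rC_j$ and go through the unmatched elements $\alpha$ of $C_{j-1}'$ from the smallest to the biggest; for each of them add to the column the smallest letter $x\ge\alpha$ such that neither $x$ nor $\overline x$ is already in it. The column so obtained, reordered, is $C_j'$. **Theorem 5.1.** Let $T=C_1\cdots C_k$, $k\ge1$, be a straight KN tableau. Then the direct way and the computation of $K_+^1(T)$ are both well defined (every letter and column they ask for exists). The column $C_k'$ consists of $rC_k$ together with extra cells, has the same length as $C_1$, and $$C_k'=K_+^1(T).$$ -/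

import Mathlib

namespace SymplecticTableau

/-- The alphabet `[±n] = {1 < ⋯ < n < n̄ < ⋯ < 1̄}`, listed in increasing order: the element with
value `i - 1 < n` is the unbarred letter `i`, and the element with value `2 * n - i` is `ī`. -/
abbrev Letter (n : ℕ) := Fin (2 * n)

/-- The letter `x̄` symmetric to `x`, with the bar of `ī` being `i`. -/
abbrev bar {n : ℕ} (x : Letter n) : Letter n := Fin.rev x

/-- The letter is one of `1, …, n`. -/
abbrev IsUnbarred {n : ℕ} (x : Letter n) : Prop := x.val < n

/-- A column is a strictly increasing sequence of letters, that is, a finite set of letters,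
displayed from top to bottom in increasing order. -/
abbrev Column (n : ℕ) := Finset (Letter n)

/-- The entries of a column from top to bottom. -/
def entries {n : ℕ} (C : Column n) : List (Letter n) := C.sort (· ≤ ·)

/-- The one column condition: whenever `i` and `ī` are both in `C`, the number of letters `x` of
`C` with `x ≤ i` or `x ≥ ī` is at most `i` (the letter `i` has value `i - 1` in `Letter n`). -/
def Admissible {n : ℕ} (C : Column n) : Prop :=
  ∀ i ∈ C, IsUnbarred i → bar i ∈ C → (C.filter fun x => x ≤ i ∨ bar i ≤ x).card ≤ i.val + 1

/-- The set `I` of unbarred letters `z` such that both `z` and `z̄` occur in `C`. -/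
def doubledLetters {n : ℕ} (C : Column n) : Finset (Letter n) :=
  C.filter fun z => IsUnbarred z ∧ bar z ∈ C

/-- Given `z₁ > z₂ > ⋯` and a set `A` of letters, choose `t₁ > t₂ > ⋯` such that `t₁` is the
greatest letter of `A` below `z₁` and `tᵢ` is the greatest letter of `A` below both `tᵢ₋₁`
and `zᵢ`. Undefined when one of these letters does not exist. -/
def chooseBelow {n : ℕ} : List (Letter n) → Finset (Letter n) → Option (List (Letter n))
  | [], _ => some []
  | z :: zs, A =>
    if h : (A.filter fun t => t < z).Nonempty then
      let t := (A.filter fun t => t < z).max' h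
      (chooseBelow zs (A.filter fun s => s < t)).map fun ts => t :: ts
    else none

/-- The set `J = {t₁ > ⋯ > t_r}` used to split `C`, where `I = {z₁ > ⋯ > z_r}`. It is undefined
exactly when the column cannot be split. -/
def splitLetters {n : ℕ} (C : Column n) : Option (Finset (Letter n)) :=
  (chooseBelow (entries (doubledLetters C)).reverse
    (Finset.univ.filter fun t => IsUnbarred t ∧ t ∉ C ∧ bar t ∉ C)).map List.toFinset

/-- The right column `rC`: each `z̄ᵢ` is changed into `t̄ᵢ`. -/
def rightCol {n : ℕ} (C : Column n) : Option (Column n) :=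
  (splitLetters C).map fun J => (C \ (doubledLetters C).image bar) ∪ J.image bar

/-- The left column `ℓC`: each `zᵢ` is changed into `tᵢ`. -/
def leftCol {n : ℕ} (C : Column n) : Option (Column n) :=
  (splitLetters C).map fun J => (C \ doubledLetters C) ∪ J

/-- The map `Φ`: the unbarred entries of `ℓC` together with the barred entries of `rC`. -/
def phi {n : ℕ} (C : Column n) : Option (Column n) :=
  (leftCol C).bind fun L => (rightCol C).map fun R =>
    (L.filter fun x => IsUnbarred x) ∪ (R.filter fun x => ¬ IsUnbarred x)

/-- The inverse of `Φ`; undefined outside the image of `Φ`. -/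
noncomputable def phiInv {n : ℕ} (D : Column n) : Option (Column n) :=
  Function.partialInv phi (some D)

/-- Two consecutive columns of a straight semistandard tableau: the heights weakly decrease and
the rows weakly increase. -/
def RowLE {n : ℕ} (C D : Column n) : Prop :=
  D.card ≤ C.card ∧
    ∀ (i : ℕ) (x y : Letter n), (entries C)[i]? = some x → (entries D)[i]? = some y → x ≤ y

/-- The columns, from left to right, form a straight semistandard tableau. -/
def Semistandard {n : ℕ} (T : List (Column n)) : Prop := T.IsChain RowLE

/-- The split form: every column `C` is replaced by the two columns `ℓC`, `rC`. -/
def splitForm {n : ℕ} : List (Column n) → Option (List (Column n))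
  | [] => some []
  | C :: T => (leftCol C).bind fun L => (rightCol C).bind fun R =>
      (splitForm T).map fun S => L :: R :: S

/-- Straight Kashiwara-Nakashima tableaux, as lists of (nonempty) columns: semistandard tableaux
with admissible columns and semistandard split form. -/
def IsStraightKN {n : ℕ} (T : List (Column n)) : Prop :=
  (∀ C ∈ T, C.Nonempty ∧ Admissible C) ∧ Semistandard T ∧
    ∃ S, splitForm T = some S ∧ Semistandard S

/-- A skew tableau with two columns. Rows are numbered from `0` downwards; the left column
occupies the rows `leftTop, …, leftTop + left.card - 1`, and the right column the rows
`rightTop, …, rightTop + right.card - 1`. -/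
structure SkewPair (n : ℕ) where
  /-- Entries of the left column. -/
  left : Column n
  /-- Entries of the right column. -/
  right : Column n
  /-- Number of cells of the inner shape in the left column. -/
  leftTop : ℕ
  /-- Number of cells of the inner shape in the right column. -/
  rightTop : ℕ

/-- The entry in row `row` of a column whose topmost cell is in row `top`, if there is one. -/
def entryAt {n : ℕ} (C : Column n) (top row : ℕ) : Option (Letter n) :=
  if top ≤ row then (entries C)[row - top]? else none

/-- The horizontal slide of the reverse symplectic jeu de taquin, in which the letter `α`, to the
left of the puncture, moves to the right column: from `C₁` to `Φ(C₂)` when it is unbarred, and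
from `Φ(C₁)` to `C₂` when it is barred. The puncture is then in the left column, where it can
only move up until it joins the inner shape. -/
noncomputable def horizontalSlide {n : ℕ} (S : SkewPair n) (α : Letter n) :
    Option (SkewPair n) :=
  if IsUnbarred α then
    (phi S.right).bind fun P => (phiInv (insert α P)).map fun C₂ =>
      { left := S.left.erase α, right := C₂, leftTop := S.leftTop + 1, rightTop := S.rightTop }
  else
    (phi S.left).bind fun P => (phiInv (P.erase α)).map fun C₁ =>
      { left := C₁, right := insert α S.right, leftTop := S.leftTop + 1, rightTop := S.rightTop }

/-- The moves of the puncture from the given row of the right column on, where `R₁ = rC₁` and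
`L₂ = ℓC₂`. If `β` is the entry of `ℓC₂` above the puncture and `α` the entry of `rC₁` to its
left, the slide is vertical when `α ≤ β` or there is no `α`, and horizontal when `α > β` or there
is no `β`. If neither exists, the puncture joins the inner shape in the right column. The entries
of the right column above the puncture are in the rows they have without the puncture. -/
noncomputable def slideFrom {n : ℕ} (S : SkewPair n) (R₁ L₂ : Column n) :
    ℕ → Option (SkewPair n)
  | 0 =>
    match entryAt R₁ S.leftTop 0 with
    | some α => horizontalSlide S α
    | none => some { S with rightTop := S.rightTop + 1 }
  | row + 1 =>
    match entryAt L₂ S.rightTop row, entryAt R₁ S.leftTop (row + 1) with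
    | some β, some α => if α ≤ β then slideFrom S R₁ L₂ row else horizontalSlide S α
    | some _, none => slideFrom S R₁ L₂ row
    | none, some α => horizontalSlide S α
    | none, none => some { S with rightTop := S.rightTop + 1 }

/-- One complete run of the reverse symplectic jeu de taquin: a puncture is added below the right
column (which must give a skew shape) and slid to the inner shape. -/
noncomputable def reverseSlide {n : ℕ} (S : SkewPair n) : Option (SkewPair n) :=
  if S.rightTop + S.right.card < S.leftTop + S.left.card then
    (rightCol S.left).bind fun R₁ => (leftCol S.right).bind fun L₂ =>
      slideFrom S R₁ L₂ (S.rightTop + S.right.card)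
  else none

/-- Play the reverse symplectic jeu de taquin until the columns have lengths `b` and `a`, which
has to happen after at most `m` runs (the value is undefined otherwise). -/
noncomputable def slideUntil {n : ℕ} (b a : ℕ) : ℕ → SkewPair n → Option (SkewPair n)
  | 0, S => if S.left.card = b ∧ S.right.card = a then some S else none
  | m + 1, S =>
    if S.left.card = b ∧ S.right.card = a then some S
    else (reverseSlide S).bind fun S' => slideUntil b a m S'

/-- Starting from the straight tableau with columns `C`, `D`, play the symplectic jeu de taquin
until the two column lengths are swapped. Nothing is done if the lengths are equal. Every run
lengthens the right column by at most one cell, so `C.card - D.card` runs are needed; the value is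
undefined if these do not suffice. -/
noncomputable def swapLengths {n : ℕ} (C D : Column n) : Option (SkewPair n) :=
  slideUntil D.card C.card (C.card - D.card)
    { left := C, right := D, leftTop := 0, rightTop := 0 }

/-- Swap the lengths of `C` and the next column, and continue with the resulting rightmost column
and the column after that; at the end return the right column of the rightmost column. -/
noncomputable def rightKeyLoop {n : ℕ} : Column n → List (Column n) → Option (Column n)
  | C, [] => rightCol C
  | C, D :: T => (swapLengths C D).bind fun S => rightKeyLoop S.right T

/-- `K₊¹(T)`, the first column of the right key of `T`, computed by the symplectic jeu de
taquin. -/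
noncomputable def rightKeyFirst {n : ℕ} : List (Column n) → Option (Column n)
  | [] => none
  | C :: T => rightKeyLoop C T

/-- Process the list `β_{m'} > ⋯ > β₁`, matching each `β` with the biggest not yet matched element
of `A` that is at most `β`. The value is the set of elements of `A` left unmatched. -/
def unmatchedAux {n : ℕ} : List (Letter n) → Finset (Letter n) → Finset (Letter n)
  | [], A => A
  | β :: l, A =>
    if h : (A.filter fun x => x ≤ β).Nonempty then
      unmatchedAux l (A.erase ((A.filter fun x => x ≤ β).max' h))
    else unmatchedAux l A

/-- The entries of `A` that are not matched in the matching between the columns `A` and `B`. -/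
def unmatched {n : ℕ} (A B : Column n) : Finset (Letter n) :=
  unmatchedAux (entries B).reverse A

/-- For every letter `α` of the list in turn, add to the column the smallest letter `x ≥ α` such
that neither `x` nor `x̄` is already in the column. Undefined if there is no such letter. -/
def fillCells {n : ℕ} : List (Letter n) → Column n → Option (Column n)
  | [], D => some D
  | α :: l, D =>
    if h : (Finset.univ.filter fun x => α ≤ x ∧ x ∉ D ∧ bar x ∉ D).Nonempty then
      fillCells l (insert ((Finset.univ.filter fun x => α ≤ x ∧ x ∉ D ∧ bar x ∉ D).min' h) D)
    else none

/-- One step of the direct way: from the (completed) right column `C'` and the next column `D` of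
the tableau, the column `rD` together with its filled extra cells. -/
def directStep {n : ℕ} (C' D : Column n) : Option (Column n) :=
  (leftCol D).bind fun L => (rightCol D).bind fun R => fillCells (entries (unmatched C' L)) R

/-- The steps of the direct way from left to right, starting with the completed column `C'`. -/
def directLoop {n : ℕ} : Column n → List (Column n) → Option (Column n)
  | C', [] => some C'
  | C', D :: T => (directStep C' D).bind fun D' => directLoop D' T

/-- The column `C_k'` produced by the direct way, starting with `rC₁`. -/
def directWay {n : ℕ} : List (Column n) → Option (Column n)
  | [] => none
  | C :: T => (rightCol C).bind fun R => directLoop R T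

end SymplecticTableau

namespace SymplecticTableau

/-! A column `C` that can be split is recorded by the pair `(L, R)` of its left and right columns:
`C = merge L R` and `Φ(C) = merge R L`. Such pairs are characterised in `IsSplit` by the walk
`height L R`, which goes up at letters of `L` and down at letters of `R`: it is nonnegative and
vanishes in the middle and at every letter that does not occur.

The matching between `R₁ = rC₁` and `L₂ = ℓC₂` is a parenthesis matching, so a letter is unmatched
when the walk `height R₁ L₂` never comes back to its level (`mem_unmatched`). For two columns, one
jeu de taquin run does one filling step. The puncture climbs until it meets the smallest unmatched
letter `a` (`slideFrom_eq`). The slide then adds to `R₂` exactly the smallest free letter `x ≥ a`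
(`IsSplit.add`), and takes `a` out of the first column (`IsSplit.exists_remove`);
`horizontalSlide_eq` treats barred and unbarred `a` alike.

The slide also changes `R₁` and `L₂`, so the remaining unmatched letters may move. They move only to
the left, past free letters that the filling takes anyway, so the final filling is unchanged
(`unmatched_slide`, through `fillCells_congr`). Hence the filled column is an invariant of the runs,
and it is the right column once nothing is unmatched (`IsStage.slideUntil_eq`). That the filling
never gets stuck is a counting argument using the bar symmetry (`exists_fillCells_aux`). Induction
on the columns finishes the proof, since each `rC_j` survives inside the filled column and so still
dominates `ℓC_{j+1}`. -/

variable {n : ℕ}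

/-! ### Counting letters and the bar symmetry -/

/-- The number of letters of `S` among the `y` smallest letters. -/
def below (S : Column n) (y : ℕ) : ℤ := ((S.filter fun x => x.val < y).card : ℤ)

/-- The letters that occur in `S`, barred or unbarred. -/
def occ (S : Column n) : Column n := Finset.univ.filter fun x => x ∈ S ∨ bar x ∈ S

/-- No letter of `S` occurs together with its symmetric letter. -/
def NoPair (S : Column n) : Prop := ∀ x ∈ S, bar x ∉ S

theorem bar_val_add (x : Letter n) : (bar x).val + x.val + 1 = 2 * n := by
  have := x.isLt
  rw [Fin.val_rev]; omega

theorem bar_bar (x : Letter n) : bar (bar x) = x := Fin.rev_rev x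

theorem mem_occ {S : Column n} {x : Letter n} : x ∈ occ S ↔ x ∈ S ∨ bar x ∈ S := by
  simp [occ]

theorem bar_mem_occ {S : Column n} {x : Letter n} : bar x ∈ occ S ↔ x ∈ occ S := by
  rw [mem_occ, mem_occ, bar_bar, or_comm]

theorem below_zero (S : Column n) : below S 0 = 0 := by simp [below]

theorem below_nonneg (S : Column n) (y : ℕ) : 0 ≤ below S y := by simp [below]

theorem below_card (S : Column n) {y : ℕ} (hy : 2 * n ≤ y) : below S y = S.card := by
  unfold below
  rw [Finset.filter_true_of_mem]
  intro x _
  have := x.isLt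
  omega

theorem below_mono (S : Column n) {s t : ℕ} (h : s ≤ t) : below S s ≤ below S t := by
  unfold below
  exact_mod_cast Finset.card_le_card fun x => by
    simp only [Finset.mem_filter]; exact fun hx => ⟨hx.1, by omega⟩

theorem below_subset {S T : Column n} (h : S ⊆ T) (y : ℕ) : below S y ≤ below T y := by
  unfold below
  exact_mod_cast Finset.card_le_card (Finset.filter_subset_filter _ h)

theorem below_insert {S : Column n} {a : Letter n} (ha : a ∉ S) (y : ℕ) :
    below (insert a S) y = below S y + if a.val < y then 1 else 0 := by
  unfold below
  rw [Finset.filter_insert]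
  split_ifs with h
  · rw [Finset.card_insert_of_notMem (by simp [ha])]; push_cast; rfl
  · simp

theorem below_erase {S : Column n} {a : Letter n} (ha : a ∈ S) (y : ℕ) :
    below (S.erase a) y = below S y - if a.val < y then 1 else 0 := by
  have := below_insert (Finset.notMem_erase a S) y
  rw [Finset.insert_erase ha] at this
  omega

theorem below_split (S : Column n) {s t : ℕ} (h : s ≤ t) :
    below S t = below S s + ((S.filter fun x => s ≤ x.val ∧ x.val < t).card : ℤ) := by
  unfold below
  rw [← Nat.cast_add, ← Finset.card_union_of_disjoint]
  · congr 2
    ext x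
    simp only [Finset.mem_filter, Finset.mem_union]
    by_cases hx : x ∈ S <;> simp only [hx, true_and, false_and, or_false]
    omega
  · rw [Finset.disjoint_left]
    intro x
    simp only [Finset.mem_filter]
    omega

theorem below_succ_of_mem {S : Column n} {a : Letter n} (ha : a ∈ S) :
    below S (a.val + 1) = below S a.val + 1 := by
  rw [below_split S (Nat.le_succ a.val)]
  congr 1
  norm_cast
  rw [Finset.card_eq_one]
  refine ⟨a, ?_⟩
  ext x
  simp only [Finset.mem_filter, Finset.mem_singleton, Fin.ext_iff]
  constructor
  · omega
  · intro h
    have : x = a := Fin.ext h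
    subst this
    exact ⟨ha, by omega⟩

theorem below_eq_of_gap {S : Column n} {s t : ℕ} (h : s ≤ t)
    (hS : ∀ x ∈ S, ¬ (s ≤ x.val ∧ x.val < t)) : below S t = below S s := by
  rw [below_split S h, Finset.filter_false_of_mem hS]
  simp

theorem below_succ_of_notMem {S : Column n} {a : Letter n} (ha : a ∉ S) :
    below S (a.val + 1) = below S a.val := by
  refine below_eq_of_gap (Nat.le_succ _) fun x hx h => ha ?_
  have : x = a := Fin.ext (by omega)
  exact this ▸ hx

theorem below_succ_le (S : Column n) (y : ℕ) : below S (y + 1) ≤ below S y + 1 := by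
  by_cases hy : y < 2 * n
  · by_cases h : (⟨y, hy⟩ : Letter n) ∈ S
    · exact (below_succ_of_mem h).le
    · exact (below_succ_of_notMem h).le.trans (by simp)
  · rw [below_card S (by omega), below_card S (by omega)]; simp

theorem below_lt_of_mem {S : Column n} {a : Letter n} (ha : a ∈ S) {y : ℕ} (h : a.val < y) :
    below S a.val < below S y := by
  have := below_succ_of_mem ha
  have := below_mono S (show a.val + 1 ≤ y from h)
  omega

theorem exists_of_below_lt {S : Column n} {s t : ℕ} (h : below S s < below S t) :
    ∃ x ∈ S, s ≤ x.val ∧ x.val < t := by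
  by_contra hc
  push Not at hc
  have hst : s ≤ t := by
    by_contra h'
    have := below_mono S (show t ≤ s by omega)
    omega
  have := below_eq_of_gap hst fun x hx hh => by have := hc x hx hh.1; omega
  omega

theorem below_compl (S : Column n) {y : ℕ} (hy : y ≤ 2 * n) :
    below Sᶜ y = y - below S y := by
  induction y with
  | zero => simp [below_zero]
  | succ y ih =>
    have ih := ih (by omega)
    by_cases h : (⟨y, hy⟩ : Letter n) ∈ S
    · have h1 := below_succ_of_mem h
      have h2 := below_succ_of_notMem (S := Sᶜ) (a := ⟨y, hy⟩) (by simpa using h)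
      simp only at h1 h2
      push_cast; omega
    · have h1 := below_succ_of_notMem h
      have h2 := below_succ_of_mem (S := Sᶜ) (a := ⟨y, hy⟩) (by simpa using h)
      simp only at h1 h2
      push_cast; omega

/-- The bar reverses the alphabet, so the letters below `y` whose bar lies in `S` mirror the letters
of `S` among the last `y`; without pairs the two kinds are disjoint. -/
theorem below_occ {S : Column n} (hS : NoPair S) {y : ℕ} (hy : y ≤ 2 * n) :
    below (occ S) y = below S y + S.card - below S (2 * n - y) := by
  induction y with
  | zero => simp [below_zero, below_card S le_rfl]
  | succ y ih =>
    have ih := ih (by omega)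
    set a : Letter n := ⟨y, hy⟩ with ha
    have hb := bar_val_add a
    have hav : a.val = y := rfl
    have e1 : (bar a).val = 2 * n - (y + 1) := by omega
    have e2 : (bar a).val + 1 = 2 * n - y := by omega
    rw [← e1, ← hav]
    rw [← e2, ← hav] at ih
    by_cases h : a ∈ S
    · have h1 := below_succ_of_mem h
      have h2 := below_succ_of_mem (S := occ S) (a := a) (mem_occ.2 (Or.inl h))
      have h3 := below_succ_of_notMem (hS a h)
      omega
    · have h1 := below_succ_of_notMem h
      by_cases h' : bar a ∈ S
      · have h2 := below_succ_of_mem (S := occ S) (a := a) (mem_occ.2 (Or.inr h'))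
        have h3 := below_succ_of_mem h'
        omega
      · have h2 := below_succ_of_notMem (S := occ S) (a := a) (by simp [mem_occ, h, h'])
        have h3 := below_succ_of_notMem h'
        omega

/-! ### Height walks -/

/-- The surplus of `A` over `B` among the `y` smallest letters. -/
def height (A B : Column n) (y : ℕ) : ℤ := below A y - below B y

theorem height_zero (A B : Column n) : height A B 0 = 0 := by simp [height, below_zero]

theorem height_succ_le (A B : Column n) (y : ℕ) : height A B (y + 1) ≤ height A B y + 1 := by
  have := below_succ_le A y
  have := below_mono B (Nat.le_succ y)
  unfold height
  simp only [Nat.succ_eq_add_one] at *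
  omega

theorem height_const (A B : Column n) {y : ℕ} (hy : 2 * n ≤ y) :
    height A B y = height A B (2 * n) := by
  simp [height, below_card _ hy, below_card _ le_rfl]

/-- The main use of the symmetry: the rises of the walk on a window and on its mirror image add up
to a quantity that depends only on which letters occur. It has a known sign when one column occupies
the whole window. -/
theorem height_symm {A B : Column n} (hA : NoPair A) (hB : NoPair B) {s t : ℕ}
    (hs : s ≤ 2 * n) (ht : t ≤ 2 * n) :
    height A B t - height A B s + (height A B (2 * n - s) - height A B (2 * n - t)) =
      (below (occ A) t - below (occ A) s) - (below (occ B) t - below (occ B) s) := by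
  have := below_occ hA hs
  have := below_occ hA ht
  have := below_occ hB hs
  have := below_occ hB ht
  unfold height
  omega

/-! ### Rows of columns as counts -/

theorem getElem?_sorted {l : List (Letter n)} (hl : l.Pairwise (· < ·)) {i : ℕ} {x : Letter n} :
    l[i]? = some x ↔ x ∈ l ∧ below l.toFinset x.val = i := by
  induction l generalizing i with
  | nil => simp
  | cons a l ih =>
    rw [List.pairwise_cons] at hl
    have hal : a ∉ l.toFinset := fun h => lt_irrefl _ (hl.1 a (List.mem_toFinset.1 h))
    have hb := fun y => below_insert hal y
    rw [List.toFinset_cons, hb]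
    have h0 : below l.toFinset a.val = 0 := by
      rw [below_eq_of_gap (Nat.zero_le _), below_zero]
      intro x hx
      have := hl.1 x (List.mem_toFinset.1 hx)
      rw [Fin.lt_def] at this
      omega
    cases i with
    | zero =>
      simp only [List.getElem?_cons_zero, Option.some.injEq, List.mem_cons, Nat.cast_zero]
      constructor
      · rintro rfl; simp [h0]
      · rintro ⟨h | h, h'⟩
        · exact h.symm
        · have := hl.1 x h
          rw [Fin.lt_def] at this
          rw [if_pos this] at h'
          have := below_nonneg l.toFinset x.val
          omega
    | succ i =>
      simp only [List.getElem?_cons_succ, ih hl.2, List.mem_cons, Nat.cast_succ]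
      constructor
      · rintro ⟨h, h'⟩
        have := hl.1 x h
        rw [Fin.lt_def] at this
        rw [if_pos this]
        exact ⟨Or.inr h, by omega⟩
      · rintro ⟨h | h, h'⟩
        · subst h; rw [h0] at h'; simp at h'; omega
        · have := hl.1 x h
          rw [Fin.lt_def] at this
          rw [if_pos this] at h'
          exact ⟨h, by omega⟩

theorem entries_pairwise (C : Column n) : (entries C).Pairwise (· < ·) :=
  (Finset.sortedLT_sort C).pairwise

theorem entries_toFinset (C : Column n) : (entries C).toFinset = C := Finset.sort_toFinset _ _

theorem mem_entries {C : Column n} {x : Letter n} : x ∈ entries C ↔ x ∈ C := Finset.mem_sort _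

theorem length_entries (C : Column n) : (entries C).length = C.card := Finset.length_sort _

theorem getElem?_entries {C : Column n} {i : ℕ} {x : Letter n} :
    (entries C)[i]? = some x ↔ x ∈ C ∧ below C x.val = i := by
  rw [getElem?_sorted (entries_pairwise C), entries_toFinset, mem_entries]

/-- Each entry of `D` has an entry of `C` at most as large in its row. This count is the only form
in which semistandardness is used later. -/
theorem RowLE.below_le {C D : Column n} (h : RowLE C D) (y : ℕ) : below D y ≤ below C y := by
  induction y with
  | zero => simp [below_zero]
  | succ y ih =>
    by_cases hy : y < 2 * n
    · by_cases hD : (⟨y, hy⟩ : Letter n) ∈ D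
      · have h1 := below_succ_of_mem hD
        simp only at h1
        by_contra hc
        have hm := below_mono C (Nat.le_succ y)
        obtain ⟨i, hi⟩ : ∃ i : ℕ, below D y = i := ⟨_, rfl⟩
        have hx := (getElem?_entries (C := D) (i := i)).2 ⟨hD, hi⟩
        have hlt : i < (entries C).length := by
          have := (List.getElem?_eq_some_iff.1 hx).1
          rw [length_entries] at *
          exact this.trans_le h.1
        have hz := List.getElem?_eq_getElem hlt
        have hle := h.2 i _ _ hz hx
        obtain ⟨hz1, hz2⟩ := getElem?_entries.1 hz
        have h3 := below_succ_of_mem hz1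
        rw [Fin.le_def] at hle
        have h4 := below_mono C (show (entries C)[i].val + 1 ≤ y + 1 by simpa using hle)
        simp only [Nat.succ_eq_add_one] at *
        omega
      · have h1 := below_succ_of_notMem hD
        simp only at h1
        rw [h1]
        exact ih.trans (below_mono C (Nat.le_succ y))
    · rw [below_card D (by omega), below_card C (by omega)]
      exact_mod_cast h.1

/-! ### The matching as a parenthesis matching -/

/-- Letters of `A` open and letters of `l` close, a common letter opening first. Matching the
biggest `b` with `m` removes both, which lowers the walk by one exactly on `(m, b]`, where `A` has
no letters. -/
theorem mem_unmatchedAux {l : List (Letter n)} (hl : l.Pairwise (· > ·)) {A : Column n}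
    {a : Letter n} :
    a ∈ unmatchedAux l A ↔
      a ∈ A ∧ ∀ y, a.val < y → height A l.toFinset a.val < height A l.toFinset y := by
  induction l generalizing A with
  | nil =>
    simp only [unmatchedAux, List.toFinset_nil, height]
    refine ⟨fun h => ⟨h, fun y hy => ?_⟩, fun h => h.1⟩
    have := below_lt_of_mem h hy
    simpa [below] using this
  | cons b l ih =>
    rw [List.pairwise_cons] at hl
    have hbl : b ∉ l.toFinset := fun h => lt_irrefl _ (hl.1 b (List.mem_toFinset.1 h))
    have hB := fun y => below_insert hbl y
    have hconst : ∀ y, b.val ≤ y → below l.toFinset y = below l.toFinset b.val := by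
      intro y hy
      refine below_eq_of_gap hy fun x hx h => ?_
      have := hl.1 x (List.mem_toFinset.1 hx)
      rw [gt_iff_lt, Fin.lt_def] at this
      omega
    rw [unmatchedAux]
    split_ifs with h
    · rw [ih hl.2]
      obtain ⟨m, hm⟩ : ∃ m, (A.filter fun x => x ≤ b).max' h = m := ⟨_, rfl⟩
      rw [hm]
      obtain ⟨hmA, hmb⟩ := Finset.mem_filter.1 (hm ▸ Finset.max'_mem _ h)
      have hmax : ∀ x ∈ A, x ≤ b → x ≤ m := fun x hx hxb =>
        hm ▸ Finset.le_max' _ _ (Finset.mem_filter.2 ⟨hx, hxb⟩)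
      have hA := fun y => below_erase hmA y
      have hgap : ∀ y, m.val < y → y ≤ b.val + 1 → below A y = below A (b.val + 1) := by
        intro y hy hyb
        refine (below_eq_of_gap hyb fun x hx hh => ?_).symm
        have := hmax x hx (by rw [Fin.le_def]; omega)
        rw [Fin.le_def] at this
        omega
      have hms := below_succ_of_mem hmA
      rw [Fin.le_def] at hmb
      simp only [Finset.mem_erase, height, List.toFinset_cons, hA, hB]
      constructor
      · rintro ⟨⟨hne, haA⟩, hy⟩
        have hne' : a.val ≠ m.val := fun h => hne (Fin.ext h)
        have hab : a.val ≤ b.val → a.val ≤ m.val := fun h => hmax a haA h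
        refine ⟨haA, fun y hay => ?_⟩
        have h1 := hy y hay
        split_ifs at h1 ⊢ <;> omega
      · rintro ⟨haA, hy⟩
        have hab : a.val ≤ b.val → a.val ≤ m.val := fun h => hmax a haA h
        -- Just after `b` the walk is back at or below its level at `m`, so `m` fails the criterion.
        have hne : a ≠ m := by
          rintro rfl
          have h1 := hy (b.val + 1) (by omega)
          have h2 := hgap (a.val + 1) (by omega) (by omega)
          have h3 := below_mono l.toFinset (show a.val ≤ b.val + 1 by omega)
          split_ifs at h1 <;> omega
        have hne' : a.val ≠ m.val := fun h => hne (Fin.ext h)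
        refine ⟨⟨hne, haA⟩, fun y hay => ?_⟩
        have h1 := hy y hay
        split_ifs at h1 ⊢ <;> try omega
        -- For `y` in `(m, b]` the walk loses a unit. The bound at `b + 1` has it to spare: `A` has
        -- no letter in between and `b` closes there.
        all_goals
          have h2 := hgap y
          have h3 := hconst y
          have h4 := hy (b.val + 1)
          have h5 := hconst (b.val + 1)
          have h6 := below_mono l.toFinset (show y ≤ b.val + 1 by omega)
          split_ifs at h4 <;> omega
    · rw [ih hl.2]
      simp only [height, List.toFinset_cons, hB]
      refine and_congr_right fun haA => forall₂_congr fun y hay => ?_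
      have : b.val < a.val := by
        by_contra hc
        exact h ⟨a, Finset.mem_filter.2 ⟨haA, by rw [Fin.le_def]; omega⟩⟩
      split_ifs <;> omega

theorem mem_unmatched {A B : Column n} {a : Letter n} :
    a ∈ unmatched A B ↔ ∀ y, a.val < y → height A B a.val < height A B y := by
  unfold unmatched
  rw [mem_unmatchedAux (List.pairwise_reverse.2 (entries_pairwise B)), List.toFinset_reverse,
    entries_toFinset]
  refine ⟨fun h => h.2, fun h => ⟨?_, h⟩⟩
  by_contra ha
  have h1 := h (a.val + 1) (Nat.lt_succ_self _)
  have h2 := below_succ_of_notMem ha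
  have h3 := below_mono B (Nat.le_succ a.val)
  unfold height at h1
  simp only [Nat.succ_eq_add_one] at *
  omega

theorem unmatched_subset (A B : Column n) : unmatched A B ⊆ A := by
  intro a ha
  unfold unmatched at ha
  rw [mem_unmatchedAux (List.pairwise_reverse.2 (entries_pairwise B))] at ha
  exact ha.1

theorem notMem_of_mem_unmatched {A B : Column n} {a : Letter n} (ha : a ∈ unmatched A B) :
    a ∉ B := by
  intro hB
  have h1 := mem_unmatched.1 ha (a.val + 1) (Nat.lt_succ_self _)
  have h2 := below_succ_of_mem hB
  have h3 := below_succ_le A a.val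
  unfold height at h1
  omega

/-- The minimum of the height from `y` on, in terms of the number of unmatched letters. -/
theorem unmatched_isLeast (A B : Column n) {y : ℕ} (hy : y ≤ 2 * n) :
    (∀ z, y ≤ z → height A B (2 * n) - (unmatched A B).card + below (unmatched A B) y
      ≤ height A B z) ∧
    ∃ z, y ≤ z ∧ z ≤ 2 * n ∧
      height A B z = height A B (2 * n) - (unmatched A B).card + below (unmatched A B) y := by
  induction hy using Nat.decreasingInduction with
  | self =>
    rw [below_card _ le_rfl]
    refine ⟨fun z hz => ?_, 2 * n, le_rfl, le_rfl, by omega⟩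
    rw [height_const A B hz]
    omega
  | of_succ y hy ih =>
    obtain ⟨ih1, z, hz1, hz2, hz3⟩ := ih
    set a : Letter n := ⟨y, hy⟩ with ha
    have hav : a.val = y := rfl
    by_cases hU : a ∈ unmatched A B
    · have h1 := below_succ_of_mem hU
      rw [hav] at h1
      have h2 := mem_unmatched.1 hU z (by omega)
      have h3 := ih1 (y + 1) le_rfl
      have h4 := height_succ_le A B y
      have h5 := mem_unmatched.1 hU (y + 1) (by omega)
      rw [hav] at h2 h5
      refine ⟨fun w hw => ?_, y, le_rfl, by omega, by omega⟩
      rcases Nat.eq_or_lt_of_le hw with rfl | hw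
      · omega
      · have := ih1 w hw
        omega
    · have h1 := below_succ_of_notMem hU
      rw [hav] at h1
      rw [← h1]
      refine ⟨fun w hw => ?_, z, by omega, hz2, hz3⟩
      rcases Nat.eq_or_lt_of_le hw with rfl | hw
      · rw [mem_unmatched] at hU
        push Not at hU
        obtain ⟨w, hw, hle⟩ := hU
        rw [hav] at hw hle
        have := ih1 w hw
        omega
      · exact ih1 w hw

/-- Before the smallest unmatched letter, the height is at least the one at that letter. -/
theorem height_le_of_isLeast {A B : Column n} {a : Letter n}
    (hmin : ∀ b ∈ unmatched A B, a ≤ b) (ha : a ∈ unmatched A B) (s : ℕ) :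
    height A B a.val ≤ height A B s := by
  rcases lt_or_ge a.val s with h | h
  · exact (mem_unmatched.1 ha s h).le
  · have h0 : below (unmatched A B) a.val = 0 := by
      rw [below_eq_of_gap (Nat.zero_le _), below_zero]
      intro x hx hh
      have := hmin x hx
      rw [Fin.le_def] at this
      omega
    have hs : below (unmatched A B) s = 0 :=
      le_antisymm (h0 ▸ below_mono _ h) (below_nonneg _ _)
    have hlt := a.isLt
    obtain ⟨h1, z, hz1, -, hz3⟩ := unmatched_isLeast A B (y := a.val) (by omega)
    have h2 := (unmatched_isLeast A B (y := s) (by omega)).1 s le_rfl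
    rcases Nat.eq_or_lt_of_le hz1 with rfl | hz
    · omega
    · have := mem_unmatched.1 ha z hz
      omega

/-- The walk has its global minimum at the smallest unmatched letter, and each unmatched letter
accounts for one unit of the final rise from there. -/
theorem card_unmatched {A B : Column n} {a : Letter n}
    (hmin : ∀ b ∈ unmatched A B, a ≤ b) (ha : a ∈ unmatched A B) :
    ((unmatched A B).card : ℤ) = height A B (2 * n) - height A B a.val := by
  obtain ⟨h1, z, -, -, h3⟩ := unmatched_isLeast A B (y := 0) (Nat.zero_le _)
  rw [below_zero] at h1 h3
  have := h1 a.val (Nat.zero_le _)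
  have := height_le_of_isLeast hmin ha z
  omega

/-! ### Filling the extra cells -/

/-- `x` is the smallest letter `≥ a` such that neither `x` nor its bar is in `D`. -/
def IsNextFree (D : Column n) (a x : Letter n) : Prop :=
  IsLeast {z | a ≤ z ∧ z ∉ occ D} x

theorem fill_filter_eq (D : Column n) (a : Letter n) :
    (Finset.univ.filter fun x => a ≤ x ∧ x ∉ D ∧ bar x ∉ D) =
      Finset.univ.filter fun x => a ≤ x ∧ x ∉ occ D := by
  ext x
  simp [mem_occ]

theorem exists_isNextFree {D : Column n} {a : Letter n} (h : ∃ z, a ≤ z ∧ z ∉ occ D) :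
    ∃ x, IsNextFree D a x := by
  obtain ⟨z, hz⟩ := h
  have hne : (Finset.univ.filter fun x => a ≤ x ∧ x ∉ occ D).Nonempty := ⟨z, by simp [hz]⟩
  refine ⟨_, (Finset.mem_filter.1 (Finset.min'_mem _ hne)).2, fun w hw => Finset.min'_le _ _ ?_⟩
  simpa using hw

theorem IsNextFree.fillCells_cons {D : Column n} {a x : Letter n} (h : IsNextFree D a x)
    (l : List (Letter n)) : fillCells (a :: l) D = fillCells l (insert x D) := by
  have hx : x ∈ Finset.univ.filter fun x => a ≤ x ∧ x ∉ D ∧ bar x ∉ D := by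
    rw [fill_filter_eq]; simpa using h.1
  have hmin : ∀ hne, (Finset.univ.filter fun x => a ≤ x ∧ x ∉ D ∧ bar x ∉ D).min' hne = x := by
    intro hne
    refine le_antisymm (Finset.min'_le _ _ hx) (h.2 ?_)
    have := Finset.min'_mem _ hne
    rw [Finset.mem_filter] at this
    exact ⟨this.2.1, by simpa [mem_occ] using this.2.2⟩
  have hne : (Finset.univ.filter fun x => a ≤ x ∧ x ∉ D ∧ bar x ∉ D).Nonempty := ⟨x, hx⟩
  rw [fillCells, dif_pos hne, hmin hne]

theorem isNextFree_of_fillCells {D K : Column n} {a : Letter n} {l : List (Letter n)}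
    (h : fillCells (a :: l) D = some K) : ∃ x, IsNextFree D a x := by
  rw [fillCells] at h
  split_ifs at h with hne
  obtain ⟨x, hx⟩ := hne
  rw [fill_filter_eq] at hx
  exact exists_isNextFree ⟨x, by simpa using hx⟩

theorem fillCells_subset_card {l : List (Letter n)} {D K : Column n}
    (h : fillCells l D = some K) : D ⊆ K ∧ K.card = D.card + l.length := by
  induction l generalizing D with
  | nil => simp only [fillCells, Option.some.injEq] at h; simp [h]
  | cons a l ih =>
    obtain ⟨x, hx⟩ := isNextFree_of_fillCells h
    rw [hx.fillCells_cons] at h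
    have hxD : x ∉ D := fun h' => hx.1.2 (mem_occ.2 (Or.inl h'))
    obtain ⟨h1, h2⟩ := ih h
    rw [Finset.card_insert_of_notMem hxD] at h2
    exact ⟨(Finset.subset_insert _ _).trans h1, by rw [h2, List.length_cons]; omega⟩

theorem below_sub_le_of_subset {S T : Column n} (h : S ⊆ T) {s t : ℕ} (hst : s ≤ t) :
    below S t - below S s ≤ below T t - below T s := by
  rw [below_split S hst, below_split T hst]
  have := Finset.card_le_card (Finset.filter_subset_filter (fun x => s ≤ x.val ∧ x.val < t) h)
  omega

theorem occ_mono {S T : Column n} (h : S ⊆ T) : occ S ⊆ occ T := fun x => by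
  simp only [mem_occ]; exact Or.imp (@h _) (@h _)

/-- Moving the letters to be filled to the left does not change the result, as long as they only
pass free letters that are taken by earlier letters. -/
theorem fillCells_congr {l₁ l₂ : List (Letter n)} {E : Column n} (hlen : l₁.length = l₂.length)
    (hl₁ : l₁.Pairwise (· < ·)) (hl₂ : l₂.Pairwise (· < ·))
    (hle : ∀ y, below l₁.toFinset y ≤ below l₂.toFinset y)
    (hfree : ∀ r, r ∉ occ E →
      below l₁.toFinset (r.val + 1) < below l₂.toFinset (r.val + 1) →
      ∃ c ≤ r.val, below (occ E)ᶜ (r.val + 1) - below (occ E)ᶜ c ≤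
        below l₁.toFinset (r.val + 1) - below l₁.toFinset c) :
    fillCells l₁ E = fillCells l₂ E := by
  induction l₁ generalizing l₂ E with
  | nil =>
    obtain rfl := List.length_eq_zero_iff.1 hlen.symm
    rfl
  | cons a l₁ ih =>
    obtain _ | ⟨b, l₂⟩ := l₂
    · simp at hlen
    rw [List.pairwise_cons] at hl₁ hl₂
    have ha : a ∉ l₁.toFinset := fun h => lt_irrefl _ (hl₁.1 a (List.mem_toFinset.1 h))
    have hb : b ∉ l₂.toFinset := fun h => lt_irrefl _ (hl₂.1 b (List.mem_toFinset.1 h))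
    simp only [List.toFinset_cons, below_insert ha, below_insert hb] at hle hfree
    have h0 : ∀ {c : Letter n} {l : List (Letter n)}, (∀ d ∈ l, c < d) →
        ∀ y, y ≤ c.val + 1 → below l.toFinset y = 0 := by
      intro c l h y hy
      rw [below_eq_of_gap (Nat.zero_le _), below_zero]
      intro x hx hh
      have := h x (List.mem_toFinset.1 hx)
      rw [Fin.lt_def] at this
      omega
    have hba : b.val ≤ a.val := by
      by_contra hc
      have h1 := hle (a.val + 1)
      have h2 := h0 hl₂.1 (a.val + 1) (by omega)
      have h3 := below_nonneg l₁.toFinset (a.val + 1)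
      split_ifs at h1 <;> omega
    -- A free letter in `[b, a)` would need a window ending at it with at least as many letters of
    -- the first list as free letters, but the first list starts only at `a`. Hence `a` and `b` fill
    -- the same letter.
    have hnext : ∀ z, z ∉ occ E → b ≤ z → a ≤ z := by
      intro z hz hbz
      by_contra haz
      rw [Fin.le_def] at hbz haz
      have h1 := h0 hl₁.1 (z.val + 1) (by omega)
      have h2 := below_nonneg l₂.toFinset (z.val + 1)
      obtain ⟨c, hc, h3⟩ := hfree z hz (by split_ifs <;> omega)
      have h4 := h0 hl₁.1 c (by omega)
      have h5 := below_succ_of_mem (S := (occ E)ᶜ) (by simpa using hz)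
      have h6 := below_mono (occ E)ᶜ hc
      split_ifs at h3 <;> omega
    by_cases hex : ∃ x, IsNextFree E a x
    · obtain ⟨x, hx⟩ := hex
      have hx' : IsNextFree E b x :=
        ⟨⟨le_trans (Fin.le_def.2 hba) hx.1.1, hx.1.2⟩, fun z hz => hx.2 ⟨hnext z hz.2 hz.1, hz.2⟩⟩
      rw [hx.fillCells_cons, hx'.fillCells_cons]
      have hsub : (occ (insert x E))ᶜ ⊆ (occ E)ᶜ :=
        Finset.compl_subset_compl.2 (occ_mono (Finset.subset_insert _ _))
      have hsub' : (occ (insert x E))ᶜ ⊆ (occ E)ᶜ.erase x := by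
        intro z hz
        refine Finset.mem_erase.2 ⟨?_, hsub hz⟩
        rintro rfl
        simp [mem_occ] at hz
      have hax := hx.1.1
      rw [Fin.le_def] at hax
      refine ih (by simpa using hlen) hl₁.2 hl₂.2 (fun y => ?_) fun r hr hlt => ?_
      · have h1 := hle y
        have h2 := below_nonneg l₂.toFinset y
        have h3 := h0 hl₁.1 y
        split_ifs at h1 <;> omega
      · have hrE : r ∉ occ E := fun h => hr (occ_mono (Finset.subset_insert _ _) h)
        have har : a.val < r.val + 1 := by
          by_contra hc
          have h1 := h0 hl₁.1 (r.val + 1) (by omega)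
          have h2 : below l₁.toFinset (r.val + 1) < below l₂.toFinset (r.val + 1) := hlt
          obtain ⟨z, hz, -, hz2⟩ := exists_of_below_lt (S := l₂.toFinset) (s := 0)
            (t := r.val + 1) (by rw [below_zero]; omega)
          have h3 := hl₂.1 z (List.mem_toFinset.1 hz)
          rw [Fin.lt_def] at h3
          have h4 := hnext r hrE (by rw [Fin.le_def]; omega)
          rw [Fin.le_def] at h4
          omega
        obtain ⟨c, hc, h1⟩ := hfree r hrE (by split_ifs <;> omega)
        refine ⟨c, hc, ?_⟩
        -- A window starting after `a` keeps its listed letters; one that contains `a` loses both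
        -- `a` and the free letter `x`, so the inequality persists.
        by_cases hac : a.val < c
        · rw [if_pos har, if_pos hac] at h1
          have h2 := below_sub_le_of_subset hsub (show c ≤ r.val + 1 by omega)
          omega
        · have hxr : x.val ≤ r.val := by
            have := hx.2 ⟨show a ≤ r by rw [Fin.le_def]; omega, hrE⟩
            rwa [Fin.le_def] at this
          have h2 := below_sub_le_of_subset hsub' (show c ≤ r.val + 1 by omega)
          have hxm : x ∈ (occ E)ᶜ := by simpa using hx.1.2
          rw [below_erase hxm, below_erase hxm, if_pos (by omega), if_neg (by omega)] at h2
          rw [if_pos har, if_neg hac] at h1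
          omega
    · have hex' : ¬ ∃ x, IsNextFree E b x := by
        rintro ⟨x, hx⟩
        exact hex (exists_isNextFree ⟨x, hnext x hx.1.2 hx.1.1, hx.1.2⟩)
      have hnone : ∀ {c : Letter n} {l : List (Letter n)}, (¬ ∃ x, IsNextFree E c x) →
          fillCells (c :: l) E = none := fun h =>
        Option.eq_none_iff_forall_ne_some.2 fun K hK => h (isNextFree_of_fillCells hK)
      rw [hnone hex, hnone hex']

theorem card_filter_ge (S : Column n) (a : Letter n) :
    ((S.filter fun x => a ≤ x).card : ℤ) = S.card - below S a.val := by
  have h1 := below_split S (show a.val ≤ 2 * n from a.isLt.le)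
  rw [below_card S le_rfl] at h1
  rw [h1, add_sub_cancel_left]
  congr 2
  ext x
  have := x.isLt
  simp only [Finset.mem_filter, Fin.le_def]
  exact and_congr_right fun _ => ⟨fun h => ⟨h, by omega⟩, fun h => h.1⟩

theorem card_occ {S : Column n} (hS : NoPair S) : ((occ S).card : ℤ) = 2 * S.card := by
  have h := below_occ hS (le_refl (2 * n))
  rw [below_card _ le_rfl, below_card _ le_rfl, Nat.sub_self, below_zero] at h
  omega

theorem card_le_of_noPair {S : Column n} (hS : NoPair S) : S.card ≤ n := by
  have h1 := card_occ hS
  have h2 := Finset.card_le_univ (occ S)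
  rw [Fintype.card_fin] at h2
  omega

/-- `V` holds the letters already processed and `φ v` is the letter added for `v`. If the filling is
stuck at `a`, let `h` be the greatest free letter and `c` the smallest unmatched letter above it.
Every letter from `c` on occurs in `E`, or is some `φ v` with `v ≥ c`, or the bar of some `φ v` with
`v ≤ bar c`; and `a` is not among these `v`. By `height_symm`, the unmatched letters of these two
ranges together number at most the letters from `c` on that do not occur in `E`, so losing `a`
leaves too few. If nothing is free, `A.card ≤ n` gives the contradiction. -/
theorem exists_fillCells_aux {A B E : Column n} (hA : NoPair A) (hB : NoPair B)
    (hE : occ E = occ B) (hle : ∀ y, below B y ≤ below A y) (l : List (Letter n))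
    (V D : Column n) (φ : Letter n → Letter n) (hl : l.Pairwise (· < ·))
    (hVl : ∀ v ∈ V, ∀ a ∈ l, v < a) (hU : unmatched A B = V ∪ l.toFinset)
    (hD : D = E ∪ V.image φ)
    (hφ : ∀ v ∈ V, v ≤ φ v ∧ ∀ z, v ≤ z → z < φ v → z ∈ occ D) :
    ∃ K, fillCells l D = some K := by
  induction l generalizing V D φ with
  | nil => exact ⟨D, rfl⟩
  | cons a l ih =>
    rw [List.pairwise_cons] at hl
    have haV : a ∉ V := fun h => lt_irrefl _ (hVl a h a List.mem_cons_self)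
    have haU : a ∈ unmatched A B := by rw [hU]; simp
    suffices hex : ∃ x, IsNextFree D a x by
      obtain ⟨x, hx⟩ := hex
      rw [hx.fillCells_cons]
      have hDx : occ D ⊆ occ (insert x D) := occ_mono (Finset.subset_insert _ _)
      have himg : V.image (Function.update φ a x) = V.image φ := Finset.image_congr fun v hv =>
        Function.update_of_ne (ne_of_mem_of_not_mem hv haV) _ _
      refine ih (insert a V) (insert x D) (Function.update φ a x) hl.2 ?_ ?_ ?_ ?_
      · intro v hv b hb
        rcases Finset.mem_insert.1 hv with rfl | hv
        · exact hl.1 b hb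
        · exact hVl v hv b (List.mem_cons_of_mem _ hb)
      · rw [hU]; ext z; simp
      · rw [Finset.image_insert, Function.update_self, himg, hD, Finset.union_insert]
      · intro v hv
        rcases Finset.mem_insert.1 hv with rfl | hv
        · rw [Function.update_self]
          refine ⟨hx.1.1, fun z hz hzx => ?_⟩
          by_contra hc
          exact absurd (hx.2 ⟨hz, fun h => hc (hDx h)⟩) (not_le.2 hzx)
        · rw [Function.update_of_ne (ne_of_mem_of_not_mem hv haV)]
          exact ⟨(hφ v hv).1, fun z hz hzx => hDx ((hφ v hv).2 z hz hzx)⟩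
    by_contra hstuck
    have hocc : ∀ z, a ≤ z → z ∈ occ D := by
      intro z hz
      by_contra hc
      exact hstuck (exists_isNextFree ⟨z, hz, hc⟩)
    have hmin0 : ((unmatched A B).card : ℤ) ≤ height A B (2 * n) := by
      obtain ⟨-, z, -, -, h⟩ := unmatched_isLeast A B (Nat.zero_le (2 * n))
      rw [below_zero] at h
      have := hle z
      unfold height at *
      omega
    have hVU : V ⊆ (unmatched A B).erase a := fun v hv =>
      Finset.mem_erase.2 ⟨fun h => haV (h ▸ hv), by rw [hU]; exact Finset.mem_union_left _ hv⟩
    have hcov : ∀ z ∈ occ D, z ∈ occ E ∨ (∃ v ∈ V, φ v = z) ∨ ∃ v ∈ V, bar (φ v) = z := by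
      intro z hz
      rw [mem_occ, hD] at hz
      simp only [Finset.mem_union, Finset.mem_image] at hz
      rcases hz with (hz | hz) | (hz | ⟨v, hv, hz⟩)
      · exact Or.inl (mem_occ.2 (Or.inl hz))
      · exact Or.inr (Or.inl hz)
      · exact Or.inl (mem_occ.2 (Or.inr hz))
      · exact Or.inr (Or.inr ⟨v, hv, by rw [hz, bar_bar]⟩)
    by_cases hfull : (occ D)ᶜ.Nonempty
    · obtain ⟨h, hh⟩ : ∃ h, (occ D)ᶜ.max' hfull = h := ⟨_, rfl⟩
      have hhm : h ∉ occ D := by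
        rw [← Finset.mem_compl, ← hh]; exact Finset.max'_mem _ _
      have hmax : ∀ z, z ∉ occ D → z ≤ h := fun z hz =>
        hh ▸ Finset.le_max' _ _ (Finset.mem_compl.2 hz)
      have hha : h < a := lt_of_not_ge fun hc => hhm (hocc h hc)
      have hbar : bar h ≤ h := hmax _ (by rwa [bar_mem_occ])
      have hne : ((unmatched A B).filter fun v => h < v).Nonempty :=
        ⟨a, Finset.mem_filter.2 ⟨haU, hha⟩⟩
      obtain ⟨c, hc⟩ : ∃ c, Finset.min' _ hne = c := ⟨_, rfl⟩
      obtain ⟨hcU, hhc⟩ := Finset.mem_filter.1 (hc ▸ Finset.min'_mem _ hne)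
      have hcmin : ∀ v ∈ unmatched A B, h < v → c ≤ v := fun v hv hhv =>
        hc ▸ Finset.min'_le _ _ (Finset.mem_filter.2 ⟨hv, hhv⟩)
      have hca : c ≤ a := hcmin a haU hha
      have hcocc : ∀ z, c ≤ z → z ∈ occ D := fun z hz => by
        by_contra hzD
        exact absurd (hmax z hzD) (not_le.2 (hhc.trans_le hz))
      have hsub : (Finset.univ.filter fun z => c ≤ z) ⊆
          ((occ E).filter fun z => c ≤ z) ∪
          ((V.filter fun v => c ≤ v).image φ ∪
            (V.filter fun v => v.val < (bar c).val + 1).image fun v => bar (φ v)) := by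
        intro z hz
        have hcz : c ≤ z := (Finset.mem_filter.1 hz).2
        simp only [Finset.mem_union, Finset.mem_filter, Finset.mem_image]
        rcases hcov z (hcocc z hcz) with hz | ⟨v, hv, rfl⟩ | ⟨v, hv, rfl⟩
        · exact Or.inl ⟨hz, hcz⟩
        · refine Or.inr (Or.inl ⟨v, ⟨hv, ?_⟩, rfl⟩)
          -- The free letter `h` is a barrier: a letter `v ≤ h` would have been filled at or before
          -- `h`.
          refine hcmin v (Finset.mem_of_mem_erase (hVU hv)) (lt_of_not_ge fun hvh => ?_)
          exact hhm ((hφ v hv).2 h hvh (hhc.trans_le hcz))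
        · refine Or.inr (Or.inr ⟨v, ⟨hv, ?_⟩, rfl⟩)
          have h1 := (hφ v hv).1
          have h2 := bar_val_add c
          have h3 := bar_val_add (φ v)
          rw [Fin.le_def] at h1 hcz
          omega
      have hcard := (Finset.card_le_card hsub).trans ((Finset.card_union_le _ _).trans
        (Nat.add_le_add_left ((Finset.card_union_le _ _).trans
          (Nat.add_le_add Finset.card_image_le Finset.card_image_le)) _))
      have k1 := card_filter_ge Finset.univ c
      have k2 := card_filter_ge (occ E) c
      have k3 := card_filter_ge ((unmatched A B).erase a) c
      have k4 := Finset.card_le_card (Finset.filter_subset_filter (fun v => c ≤ v) hVU)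
      have k5 : ((V.filter fun v => v.val < (bar c).val + 1).card : ℤ) ≤
          below (unmatched A B) ((bar c).val + 1) :=
        below_subset (hVU.trans (Finset.erase_subset _ _)) _
      have k6 : below (Finset.univ : Column n) c.val = c.val := by
        have := below_compl (∅ : Column n) c.isLt.le
        simpa [below] using this
      rw [below_erase haU, if_neg (by rw [Fin.le_def] at hca; omega),
        Finset.card_erase_of_mem haU] at k3
      have k7 := Finset.card_pos.2 ⟨a, haU⟩
      rw [Finset.card_univ, Fintype.card_fin] at k1
      have hbc := bar_val_add c
      have hc2 : 2 * n - c.val = (bar c).val + 1 := by omega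
      have m1 := height_symm hA hB c.isLt.le (le_refl (2 * n))
      rw [hc2, Nat.sub_self, height_zero, below_card _ le_rfl, below_card _ le_rfl, ← hE] at m1
      have m2 := card_filter_ge (occ A) c
      have m3 := Finset.card_le_card (Finset.filter_subset_filter (fun v => c ≤ v)
        (Finset.subset_univ (occ A)))
      obtain ⟨-, z, hz1, -, hz3⟩ := unmatched_isLeast A B c.isLt.le
      have m4 : height A B c.val ≤ height A B z := by
        rcases Nat.eq_or_lt_of_le hz1 with rfl | hz
        · exact le_rfl
        · exact (mem_unmatched.1 hcU z hz).le
      have m5 := (unmatched_isLeast A B (y := (bar c).val + 1) (by omega)).1 _ le_rfl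
      omega
    · have hall : occ D = Finset.univ := by
        rw [Finset.not_nonempty_iff_eq_empty] at hfull
        rwa [Finset.compl_eq_empty_iff] at hfull
      have hsub : (Finset.univ : Column n) ⊆
          occ E ∪ (V.image φ ∪ V.image fun v => bar (φ v)) := by
        intro z _
        simp only [Finset.mem_union, Finset.mem_image]
        exact hcov z (hall ▸ Finset.mem_univ z)
      have hcard := (Finset.card_le_card hsub).trans ((Finset.card_union_le _ _).trans
        (Nat.add_le_add_left ((Finset.card_union_le _ _).trans
          (Nat.add_le_add Finset.card_image_le Finset.card_image_le)) _))
      have k1 := Finset.card_le_card hVU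
      rw [Finset.card_erase_of_mem haU] at k1
      have k2 := Finset.card_pos.2 ⟨a, haU⟩
      have k3 := card_occ hB
      have k4 := card_le_of_noPair hA
      rw [Finset.card_univ, Fintype.card_fin, hE] at hcard
      unfold height at hmin0
      rw [below_card _ le_rfl, below_card _ le_rfl] at hmin0
      omega

/-- The extra cells can be filled when every letter of `B` can be matched. -/
theorem exists_fillCells {A B E : Column n} (hA : NoPair A) (hB : NoPair B)
    (hE : occ E = occ B) (hle : ∀ y, below B y ≤ below A y) :
    ∃ K, fillCells (entries (unmatched A B)) E = some K :=
  exists_fillCells_aux hA hB hE hle _ ∅ E id (entries_pairwise _) (by simp)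
    (by simp [entries_toFinset]) (by simp) (by simp)

/-! ### The greedy choice of splitting letters by counting -/

/-- `J` is the set of letters of `A` that `chooseBelow` chooses for the letters of `I`. -/
structure IsChoice (I A J : Column n) : Prop where
  subset : J ⊆ A
  card_eq : J.card = I.card
  below_le : ∀ y, below I y ≤ below J y
  below_eq : ∀ a ∈ A, a ∉ J → below J a.val = below I a.val

theorem below_eq_card {S : Column n} {y : ℕ} (h : ∀ x ∈ S, x.val < y) : below S y = S.card := by
  unfold below
  rw [Finset.filter_true_of_mem h]

theorem below_le_card (S : Column n) (y : ℕ) : below S y ≤ S.card := by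
  unfold below
  exact_mod_cast Finset.card_filter_le _ _

/-- The greedy choice never passes over an available letter: if `a` is left unused, every `z` above
`a` gets its `t` above `a`, while `t < z` gives the converse. So the two counts agree at `a`. -/
theorem isChoice_of_chooseBelow {zs : List (Letter n)} (hzs : zs.Pairwise (· > ·))
    {A : Column n} (hA : ∀ z ∈ zs, z ∉ A) {ts : List (Letter n)}
    (h : chooseBelow zs A = some ts) : IsChoice zs.toFinset A ts.toFinset := by
  induction zs generalizing A ts with
  | nil =>
    simp only [chooseBelow, Option.some.injEq] at h
    subst h
    exact ⟨by simp, rfl, fun y => le_rfl, fun _ _ _ => rfl⟩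
  | cons z zs ih =>
    rw [List.pairwise_cons] at hzs
    rw [chooseBelow] at h
    split_ifs at h with hne
    obtain ⟨t, ht⟩ : ∃ t, (A.filter fun t => t < z).max' hne = t := ⟨_, rfl⟩
    simp only [ht] at h
    obtain ⟨htA, htz⟩ := Finset.mem_filter.1 (ht ▸ Finset.max'_mem _ hne)
    have hmax : ∀ a ∈ A, a < z → a ≤ t := fun a ha haz =>
      ht ▸ Finset.le_max' _ _ (Finset.mem_filter.2 ⟨ha, haz⟩)
    obtain ⟨us, hus, rfl⟩ := Option.map_eq_some_iff.1 h
    have hc := ih hzs.2 (fun w hw hwA => hA w (List.mem_cons_of_mem _ hw)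
      (Finset.mem_filter.1 hwA).1) hus
    have hut : ∀ u ∈ us.toFinset, u.val < t.val := fun u hu =>
      Fin.lt_def.1 (Finset.mem_filter.1 (hc.subset hu)).2
    have hzz : ∀ w ∈ zs.toFinset, w.val < z.val := fun w hw =>
      Fin.lt_def.1 (hzs.1 w (List.mem_toFinset.1 hw))
    have h1 : t ∉ us.toFinset := fun h => lt_irrefl _ (hut t h)
    have h2 : z ∉ zs.toFinset := fun h => lt_irrefl _ (hzz z h)
    rw [Fin.lt_def] at htz
    simp only [List.toFinset_cons]
    refine ⟨?_, ?_, fun y => ?_, fun a ha hat => ?_⟩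
    · intro u hu
      rcases Finset.mem_insert.1 hu with rfl | hu
      · exact htA
      · exact (Finset.mem_filter.1 (hc.subset hu)).1
    · rw [Finset.card_insert_of_notMem h1, Finset.card_insert_of_notMem h2, hc.card_eq]
    · rw [below_insert h1, below_insert h2]
      have := hc.below_le y
      split_ifs <;> omega
    · rw [below_insert h1, below_insert h2]
      rw [Finset.mem_insert, not_or] at hat
      have hne : a.val ≠ t.val := fun h => hat.1 (Fin.ext h)
      by_cases hlt : a.val < t.val
      · have := hc.below_eq a (Finset.mem_filter.2 ⟨ha, Fin.lt_def.2 hlt⟩) hat.2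
        split_ifs <;> omega
      · have haz : ¬ a.val < z.val := fun h => by
          have := hmax a ha (Fin.lt_def.2 h)
          rw [Fin.le_def] at this
          omega
        have hnz : a.val ≠ z.val := fun h => hA z List.mem_cons_self (Fin.ext h ▸ ha)
        rw [below_eq_card fun x hx => (hut x hx).trans (by omega),
          below_eq_card fun x hx => (hzz x hx).trans (by omega), hc.card_eq]
        split_ifs <;> omega

theorem IsChoice.chooseBelow_eq {zs : List (Letter n)} (hzs : zs.Pairwise (· > ·))
    {A J : Column n} (hA : ∀ z ∈ zs, z ∉ A) (h : IsChoice zs.toFinset A J) :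
    ∃ ts, chooseBelow zs A = some ts ∧ ts.toFinset = J := by
  induction zs generalizing A J with
  | nil =>
    have := h.card_eq
    simp only [List.toFinset_nil, Finset.card_empty, Finset.card_eq_zero] at this
    exact ⟨[], rfl, by simp [this]⟩
  | cons z zs ih =>
    rw [List.pairwise_cons] at hzs
    have hzz : ∀ w ∈ zs.toFinset, w.val < z.val := fun w hw =>
      Fin.lt_def.1 (hzs.1 w (List.mem_toFinset.1 hw))
    have hz : z ∉ zs.toFinset := fun h => lt_irrefl _ (hzz z h)
    obtain ⟨hsub, hcard, hle, heq⟩ := h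
    simp only [List.toFinset_cons, Finset.card_insert_of_notMem hz, below_insert hz] at *
    have hJ : J.Nonempty := Finset.card_pos.1 (by omega)
    obtain ⟨j, hj⟩ : ∃ j, J.max' hJ = j := ⟨_, rfl⟩
    have hjJ : j ∈ J := hj ▸ Finset.max'_mem _ _
    have hmax : ∀ x ∈ J, x.val ≤ j.val := fun x hx => Fin.le_def.1 (hj ▸ Finset.le_max' _ _ hx)
    have hjz : j.val < z.val := by
      by_contra hc
      have hne : j.val ≠ z.val := fun h => hA z List.mem_cons_self (Fin.ext h ▸ hsub hjJ)
      have h1 := hle j.val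
      rw [below_eq_card fun x hx => (hzz x hx).trans (by omega), if_pos (by omega)] at h1
      have h2 := below_lt_of_mem hjJ (Nat.lt_succ_self _)
      have h3 := below_le_card J (j.val + 1)
      simp only [Nat.succ_eq_add_one] at h2
      omega
    -- An available letter strictly between `j` and `z` would have all of `J` below it, but not `z`,
    -- contradicting the equality of counts at unused letters.
    have hjA : ∀ a ∈ A, a < z → a ≤ j := by
      intro a ha haz
      by_contra hc
      rw [Fin.le_def] at hc
      rw [Fin.lt_def] at haz
      have h1 := heq a ha fun h => hc (hmax a h)
      rw [below_eq_card fun x hx => (hmax x hx).trans_lt (by omega), if_neg (by omega)] at h1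
      have h2 := below_le_card zs.toFinset a.val
      omega
    have hne : (A.filter fun t => t < z).Nonempty :=
      ⟨j, Finset.mem_filter.2 ⟨hsub hjJ, Fin.lt_def.2 hjz⟩⟩
    have ht : (A.filter fun t => t < z).max' hne = j := by
      refine le_antisymm (Finset.max'_le _ _ _ fun a ha => ?_) (Finset.le_max' _ _ ?_)
      · exact hjA a (Finset.mem_filter.1 ha).1 (Finset.mem_filter.1 ha).2
      · exact Finset.mem_filter.2 ⟨hsub hjJ, Fin.lt_def.2 hjz⟩
    have hlt : ∀ x ∈ J.erase j, x.val < j.val := fun x hx => by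
      have h1 := hmax x (Finset.mem_of_mem_erase hx)
      have h2 : x.val ≠ j.val := fun h => Finset.ne_of_mem_erase hx (Fin.ext h)
      omega
    obtain ⟨ts, hts, hJts⟩ := ih hzs.2 (A := A.filter fun s => s < j) (J := J.erase j)
      (fun w hw hwA => hA w (List.mem_cons_of_mem _ hw) (Finset.mem_filter.1 hwA).1)
      ⟨fun x hx => Finset.mem_filter.2 ⟨hsub (Finset.mem_of_mem_erase hx), Fin.lt_def.2 (hlt x hx)⟩,
        by rw [Finset.card_erase_of_mem hjJ]; omega,
        fun y => by
          have h1 := hle y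
          have h2 := below_le_card zs.toFinset y
          by_cases hy : j.val < y
          · rw [below_eq_card fun x hx => (hlt x hx).trans hy, Finset.card_erase_of_mem hjJ]
            omega
          · rw [below_erase hjJ, if_neg hy]
            split_ifs at h1 <;> omega,
        fun a ha haJ => by
          obtain ⟨haA, haj⟩ := Finset.mem_filter.1 ha
          rw [Fin.lt_def] at haj
          have h1 := heq a haA fun h => haJ (Finset.mem_erase.2 ⟨fun h => by simp [h] at haj, h⟩)
          rw [below_erase hjJ]
          split_ifs at h1 ⊢ <;> omega⟩
    refine ⟨j :: ts, ?_, by rw [List.toFinset_cons, hJts, Finset.insert_erase hjJ]⟩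
    rw [chooseBelow, dif_pos hne]
    simp only [ht, hts, Option.map_some]

/-! ### Split pairs -/

/-- The barred letters of `L` together with the unbarred letters of `R`. -/
def merge (L R : Column n) : Column n :=
  L.filter (fun x => ¬ IsUnbarred x) ∪ R.filter fun x => IsUnbarred x

theorem mem_merge {L R : Column n} {x : Letter n} :
    x ∈ merge L R ↔ (x ∈ L ∧ ¬ IsUnbarred x) ∨ (x ∈ R ∧ IsUnbarred x) := by
  simp [merge]

theorem isUnbarred_bar {x : Letter n} : IsUnbarred (bar x) ↔ ¬ IsUnbarred x := by
  have := bar_val_add x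
  unfold IsUnbarred
  omega

/-- With the same letters occurring, the rises on mirror windows cancel; the full window is its own
mirror, so the total height is zero. -/
theorem height_symm_of_occ_eq {L R : Column n} (hL : NoPair L) (hR : NoPair R)
    (h : occ L = occ R) {y : ℕ} (hy : y ≤ 2 * n) :
    height L R (2 * n - y) = height L R y := by
  have h1 := height_symm hL hR (Nat.zero_le (2 * n)) (le_refl (2 * n))
  have h2 := height_symm hL hR (Nat.zero_le (2 * n)) hy
  rw [h] at h1 h2
  rw [Nat.sub_self, Nat.sub_zero, height_zero] at h1
  rw [Nat.sub_zero, height_zero] at h2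
  omega

theorem height_bar_of_notMem {L R : Column n} (hL : NoPair L) (hR : NoPair R)
    (h : occ L = occ R) {x : Letter n} (hx : x ∉ occ L) :
    height L R (bar x).val = height L R x.val := by
  have h1 := bar_val_add x
  have hs := height_symm_of_occ_eq hL hR h (y := x.val + 1) (by omega)
  rw [show 2 * n - (x.val + 1) = (bar x).val by omega] at hs
  rw [hs]
  have h2 : x ∉ L := fun h' => hx (mem_occ.2 (Or.inl h'))
  have h3 : x ∉ R := fun h' => hx (h ▸ mem_occ.2 (Or.inl h'))
  unfold height
  rw [below_succ_of_notMem h2, below_succ_of_notMem h3]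

/-- The pairs `(ℓC, rC)`, for columns `C` that can be split. -/
structure IsSplit (L R : Column n) : Prop where
  left : NoPair L
  right : NoPair R
  occ_eq : occ L = occ R
  nonneg : ∀ y, 0 ≤ height L R y
  mid : height L R n = 0
  free : ∀ x, x ∉ occ L → height L R x.val = 0

theorem IsSplit.total {L R : Column n} (h : IsSplit L R) : height L R (2 * n) = 0 := by
  have := height_symm_of_occ_eq h.left h.right h.occ_eq (Nat.zero_le _)
  rwa [height_zero, Nat.sub_zero] at this

/-- The letters `t` with `t` in `ℓC` and `t̄` in `rC`. -/
def openers (L R : Column n) : Column n := L.filter fun z => IsUnbarred z ∧ bar z ∈ R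

theorem mem_openers {L R : Column n} {x : Letter n} :
    x ∈ openers L R ↔ x ∈ L ∧ IsUnbarred x ∧ bar x ∈ R := by
  simp [openers]

/-- Letters in both columns cancel, and a letter in just one of them has its bar in the other. So on
the unbarred half the walk counts the letters of `J` minus those of `I`. -/
theorem height_openers {L R : Column n} (hL : NoPair L) (hR : NoPair R) (h : occ L = occ R)
    {y : ℕ} (hy : y ≤ n) :
    height (openers L R) (openers R L) y = height L R y := by
  induction y with
  | zero => rw [height_zero, height_zero]
  | succ y ih =>
    have ih := ih (by omega)
    set a : Letter n := ⟨y, by omega⟩ with ha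
    have hav : a.val = y := rfl
    have hau : IsUnbarred a := by unfold IsUnbarred; omega
    rw [← hav] at ih ⊢
    have ho : (a ∈ L ∨ bar a ∈ L) ↔ (a ∈ R ∨ bar a ∈ R) := by rw [← mem_occ, h, mem_occ]
    have h1 := hL a
    have h2 := hR a
    unfold height at *
    by_cases haL : a ∈ L <;> by_cases haR : a ∈ R
    · rw [below_succ_of_mem haL, below_succ_of_mem haR,
        below_succ_of_notMem fun h => h2 haR (mem_openers.1 h).2.2,
        below_succ_of_notMem fun h => h1 haL (mem_openers.1 h).2.2]
      omega
    · rw [below_succ_of_mem haL, below_succ_of_notMem haR,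
        below_succ_of_mem (mem_openers.2 ⟨haL, hau, by tauto⟩),
        below_succ_of_notMem fun h => haR (mem_openers.1 h).1]
      omega
    · rw [below_succ_of_notMem haL, below_succ_of_mem haR,
        below_succ_of_notMem fun h => haL (mem_openers.1 h).1,
        below_succ_of_mem (mem_openers.2 ⟨haR, hau, by tauto⟩)]
      omega
    · rw [below_succ_of_notMem haL, below_succ_of_notMem haR,
        below_succ_of_notMem fun h => haL (mem_openers.1 h).1,
        below_succ_of_notMem fun h => haR (mem_openers.1 h).1]
      omega

theorem below_openers {L R : Column n} {y : ℕ} (hy : n ≤ y) :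
    below (openers L R) y = (openers L R).card :=
  below_eq_card fun _ hx => lt_of_lt_of_le (mem_openers.1 hx).2.1 hy

/-- The letters available for splitting. -/
def available (C : Column n) : Column n :=
  Finset.univ.filter fun t => IsUnbarred t ∧ t ∉ C ∧ bar t ∉ C

theorem splitLetters_isChoice {C J : Column n} (h : splitLetters C = some J) :
    IsChoice (doubledLetters C) (available C) J := by
  obtain ⟨ts, hts, rfl⟩ := Option.map_eq_some_iff.1 h
  have := isChoice_of_chooseBelow (List.pairwise_reverse.2 (entries_pairwise _)) ?_ hts
  · rwa [List.toFinset_reverse, entries_toFinset] at this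
  · intro z hz
    rw [List.mem_reverse, mem_entries, doubledLetters, Finset.mem_filter] at hz
    simp [hz.1]

theorem IsChoice.splitLetters_eq {C J : Column n}
    (h : IsChoice (doubledLetters C) (available C) J) : splitLetters C = some J := by
  rw [← entries_toFinset (doubledLetters C), ← List.toFinset_reverse] at h
  have hav : ∀ z ∈ (entries (doubledLetters C)).reverse, z ∉ available C := by
    intro z hz
    rw [List.mem_reverse, mem_entries, doubledLetters, Finset.mem_filter] at hz
    simp [available, hz.1]
  obtain ⟨ts, hts, rfl⟩ := h.chooseBelow_eq (List.pairwise_reverse.2 (entries_pairwise _)) hav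
  exact Option.map_eq_some_iff.2 ⟨ts, hts, rfl⟩

theorem mem_image_bar {S : Column n} {x : Letter n} : x ∈ S.image bar ↔ bar x ∈ S := by
  rw [Finset.mem_image]
  exact ⟨fun ⟨y, hy, h⟩ => by rwa [← h, bar_bar], fun h => ⟨_, h, bar_bar x⟩⟩

theorem mem_doubledLetters {C : Column n} {x : Letter n} :
    x ∈ doubledLetters C ↔ x ∈ C ∧ IsUnbarred x ∧ bar x ∈ C := by
  simp [doubledLetters]

theorem mem_available {C : Column n} {x : Letter n} :
    x ∈ available C ↔ IsUnbarred x ∧ x ∉ C ∧ bar x ∉ C := by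
  simp [available]

theorem doubledLetters_merge (L R : Column n) : doubledLetters (merge L R) = openers R L := by
  ext x
  rw [mem_doubledLetters, mem_openers, mem_merge, mem_merge, isUnbarred_bar]
  tauto

/-- Read through `height_openers`, the conditions of `IsSplit` become those of `IsChoice`: `nonneg`
is `below_le`, `mid` is `card_eq`, and `free` is `below_eq`. -/
theorem IsSplit.splitLetters_merge {L R : Column n} (h : IsSplit L R) :
    splitLetters (merge L R) = some (openers L R) := by
  apply IsChoice.splitLetters_eq
  rw [doubledLetters_merge]
  have hh := fun {y} hy => height_openers h.left h.right h.occ_eq (y := y) hy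
  have hcard : (openers L R).card = (openers R L).card := by
    have h1 := hh le_rfl
    rw [h.mid, height, below_openers le_rfl, below_openers le_rfl] at h1
    omega
  refine ⟨fun x hx => ?_, hcard, fun y => ?_, fun a ha haJ => ?_⟩
  · rw [mem_openers] at hx
    have h1 := h.left x hx.1
    have h2 := h.right (bar x) hx.2.2
    rw [bar_bar] at h2
    rw [mem_available, mem_merge, mem_merge, isUnbarred_bar]
    tauto
  · rcases le_total y n with hy | hy
    · have h1 := hh hy
      have h2 := h.nonneg y
      rw [height] at h1
      omega
    · rw [below_openers hy, below_openers hy, hcard]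
  · rw [mem_available, mem_merge, mem_merge, isUnbarred_bar] at ha
    rw [mem_openers] at haJ
    have hocc : a ∉ occ L := by
      intro hc
      have h1 := hc
      rw [h.occ_eq] at h1
      rw [mem_occ] at hc h1
      tauto
    have h1 := hh (y := a.val) (Nat.le_of_lt ha.1)
    rw [h.free a hocc, height] at h1
    omega

theorem IsSplit.leftCol_merge {L R : Column n} (h : IsSplit L R) :
    leftCol (merge L R) = some L := by
  rw [leftCol, h.splitLetters_merge, Option.map_some, doubledLetters_merge]
  congr 1
  ext x
  have h1 := h.left x
  have h2 : (x ∈ L ∨ bar x ∈ L) ↔ (x ∈ R ∨ bar x ∈ R) := by rw [← mem_occ, h.occ_eq, mem_occ]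
  have h3 := h.right x
  rw [Finset.mem_union, Finset.mem_sdiff, mem_openers, mem_openers, mem_merge]
  tauto

theorem IsSplit.rightCol_merge {L R : Column n} (h : IsSplit L R) :
    rightCol (merge L R) = some R := by
  rw [rightCol, h.splitLetters_merge, Option.map_some, doubledLetters_merge]
  congr 1
  ext x
  have h1 := h.left x
  have h2 : (x ∈ L ∨ bar x ∈ L) ↔ (x ∈ R ∨ bar x ∈ R) := by rw [← mem_occ, h.occ_eq, mem_occ]
  have h3 := h.right x
  rw [Finset.mem_union, Finset.mem_sdiff, mem_image_bar, mem_image_bar, mem_openers, mem_openers,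
    mem_merge, isUnbarred_bar, bar_bar]
  tauto

theorem IsSplit.phi_merge {L R : Column n} (h : IsSplit L R) :
    phi (merge L R) = some (merge R L) := by
  rw [phi, h.leftCol_merge, h.rightCol_merge, Option.bind_some, Option.map_some, merge,
    Finset.union_comm]

/-- Every column that can be split comes from a split pair. -/
theorem exists_isSplit {C L : Column n} (h : leftCol C = some L) :
    ∃ R, IsSplit L R ∧ C = merge L R := by
  obtain ⟨J, hJ, rfl⟩ := Option.map_eq_some_iff.1 h
  have hc := splitLetters_isChoice hJ
  have hJA : ∀ x ∈ J, IsUnbarred x ∧ x ∉ C ∧ bar x ∉ C := fun x hx =>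
    mem_available.1 (hc.subset hx)
  obtain ⟨L, hL⟩ : ∃ L, (C \ doubledLetters C) ∪ J = L := ⟨_, rfl⟩
  obtain ⟨R, hR⟩ : ∃ R, (C \ (doubledLetters C).image bar) ∪ J.image bar = R := ⟨_, rfl⟩
  have mL : ∀ x, x ∈ L ↔ (x ∈ C ∧ ¬ (IsUnbarred x ∧ bar x ∈ C)) ∨ x ∈ J := by
    intro x
    rw [← hL, Finset.mem_union, Finset.mem_sdiff, mem_doubledLetters]
    tauto
  have mR : ∀ x, x ∈ R ↔ (x ∈ C ∧ ¬ (¬ IsUnbarred x ∧ bar x ∈ C)) ∨ bar x ∈ J := by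
    intro x
    rw [← hR, Finset.mem_union, Finset.mem_sdiff, mem_image_bar, mem_image_bar,
      mem_doubledLetters, bar_bar, isUnbarred_bar]
    tauto
  rw [hL]
  have nL : NoPair L := by
    intro x
    have h1 := hJA x
    have h2 := hJA (bar x)
    rw [isUnbarred_bar, bar_bar] at h2
    rw [mL, mL, isUnbarred_bar, bar_bar]
    tauto
  have nR : NoPair R := by
    intro x
    have h1 := hJA x
    have h2 := hJA (bar x)
    rw [isUnbarred_bar, bar_bar] at h2
    rw [mR, mR, isUnbarred_bar, bar_bar]
    tauto
  have hocc : occ L = occ R := by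
    ext x
    rw [mem_occ, mem_occ, mL, mL, mR, mR, isUnbarred_bar, bar_bar]
    tauto
  have hCm : C = merge L R := by
    ext x
    have h1 := hJA x
    have h2 := hJA (bar x)
    rw [isUnbarred_bar, bar_bar] at h2
    rw [mem_merge, mL, mR]
    tauto
  have hI : doubledLetters C = openers R L := by rw [hCm, doubledLetters_merge]
  have hJo : J = openers L R := by
    ext x
    have h1 := hJA x
    have h2 := hJA (bar x)
    rw [isUnbarred_bar, bar_bar] at h2
    rw [mem_openers, mL, mR, isUnbarred_bar, bar_bar]
    tauto
  rw [hI, hJo] at hc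
  have hh := fun {y} hy => height_openers nL nR hocc (y := y) hy
  have hnn : ∀ y, y ≤ n → 0 ≤ height L R y := by
    intro y hy
    rw [← hh hy, height]
    have := hc.below_le y
    omega
  have hfree : ∀ x, x ∉ occ L → IsUnbarred x → height L R x.val = 0 := by
    intro x hx hxu
    have hx' := hx
    rw [hocc] at hx'
    rw [mem_occ] at hx hx'
    have := hc.below_eq x (mem_available.2 ⟨hxu, by rw [hCm, mem_merge]; tauto,
      by rw [hCm, mem_merge]; tauto⟩) (by rw [mem_openers]; tauto)
    rw [← hh (Nat.le_of_lt hxu), height]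
    omega
  refine ⟨R, ⟨nL, nR, hocc, fun y => ?_, ?_, fun x hx => ?_⟩, hCm⟩
  · rcases le_total y n with hy | hy
    · exact hnn y hy
    · rcases le_total y (2 * n) with hy' | hy'
      · rw [← height_symm_of_occ_eq nL nR hocc hy']
        exact hnn _ (by omega)
      · rw [height_const _ _ hy', ← height_symm_of_occ_eq nL nR hocc le_rfl, Nat.sub_self,
          height_zero]
  · rw [← hh le_rfl, height, below_openers le_rfl, below_openers le_rfl, hc.card_eq, sub_self]
  · by_cases hxu : IsUnbarred x
    · exact hfree x hx hxu
    · rw [← height_bar_of_notMem nL nR hocc hx]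
      exact hfree _ (by rwa [bar_mem_occ]) (isUnbarred_bar.2 hxu)

/-! ### Injectivity of `Φ` -/

theorem exists_isSplit_of_phi {C D : Column n} (h : phi C = some D) :
    ∃ L R, IsSplit L R ∧ C = merge L R ∧ D = merge R L := by
  obtain ⟨L, hL, -⟩ := Option.bind_eq_some_iff.1 h
  obtain ⟨R, hs, rfl⟩ := exists_isSplit hL
  rw [hs.phi_merge, Option.some.injEq] at h
  exact ⟨L, R, hs, rfl, h.symm⟩

/-- If `a` were missing from `R'` it would be free for the second pair, whose walk then vanishes at
`a`. The first walk agrees with it up to `a`, and its down step there would make it negative. -/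
theorem IsSplit.mem_right_of_mem {L R L' R' : Column n} (h : IsSplit L R) (h' : IsSplit L' R')
    (hL : ∀ x, IsUnbarred x → (x ∈ L ↔ x ∈ L')) (hR : ∀ x, ¬ IsUnbarred x → (x ∈ R ↔ x ∈ R'))
    {a : Letter n} (ha : IsUnbarred a) (hlt : ∀ x, x < a → (x ∈ R ↔ x ∈ R')) (haR : a ∈ R) :
    a ∈ R' := by
  by_contra hc
  have hb : bar a ∉ R' := by
    rw [← hR _ (by rw [isUnbarred_bar]; exact not_not.2 ha)]
    exact h.right a haR
  have hfree : a ∉ occ L' := by rw [h'.occ_eq, mem_occ]; tauto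
  have haL : a ∉ L := by
    rw [hL a ha]
    exact fun h => hfree (mem_occ.2 (Or.inl h))
  have h0 := h'.free a hfree
  have hle : ∀ x : Letter n, x.val < a.val → IsUnbarred x := fun x hx => lt_trans hx ha
  have e1 : below L a.val = below L' a.val := by
    unfold below
    congr 2
    ext x
    simp only [Finset.mem_filter]
    exact and_congr_left fun hx => hL x (hle x hx)
  have e2 : below R a.val = below R' a.val := by
    unfold below
    congr 2
    ext x
    simp only [Finset.mem_filter]
    exact and_congr_left fun hx => hlt x (Fin.lt_def.2 hx)
  have h1 := h.nonneg (a.val + 1)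
  unfold height at *
  rw [below_succ_of_notMem haL, below_succ_of_mem haR] at h1
  omega

/-- `merge R L` shows the unbarred half of `L` and the barred half of `R`. The unbarred half of `R`
is recovered in increasing order, and then the barred half of `L` from the letters that occur. -/
theorem phi_injective {C C' D : Column n} (h : phi C = some D) (h' : phi C' = some D) :
    C = C' := by
  obtain ⟨L, R, hs, rfl, rfl⟩ := exists_isSplit_of_phi h
  obtain ⟨L', R', hs', rfl, hD⟩ := exists_isSplit_of_phi h'
  have hm : ∀ x, (x ∈ merge R L ↔ x ∈ merge R' L') := fun x => by rw [hD]
  have hL : ∀ x, IsUnbarred x → (x ∈ L ↔ x ∈ L') := fun x hx => by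
    have := hm x
    rw [mem_merge, mem_merge] at this
    tauto
  have hR : ∀ x, ¬ IsUnbarred x → (x ∈ R ↔ x ∈ R') := fun x hx => by
    have := hm x
    rw [mem_merge, mem_merge] at this
    tauto
  have hRR : ∀ x, x ∈ R ↔ x ∈ R' := by
    intro x
    induction x using WellFoundedLT.induction with
    | ind x ih =>
      by_cases hx : IsUnbarred x
      · exact ⟨hs.mem_right_of_mem hs' hL hR hx ih,
          hs'.mem_right_of_mem hs (fun x hx => (hL x hx).symm) (fun x hx => (hR x hx).symm) hx
            fun y hy => (ih y hy).symm⟩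
      · exact hR x hx
  have hRe : R = R' := Finset.ext hRR
  subst hRe
  have hocc : ∀ x, (x ∈ L ∨ bar x ∈ L) ↔ (x ∈ L' ∨ bar x ∈ L') := fun x => by
    rw [← mem_occ, ← mem_occ, hs.occ_eq, hs'.occ_eq]
  ext x
  rw [mem_merge, mem_merge]
  have h1 := hL (bar x)
  rw [isUnbarred_bar] at h1
  have h2 := hocc x
  have h3 := hs.left x
  have h4 := hs'.left x
  tauto

theorem phiInv_eq {C D : Column n} (h : phi C = some D) : phiInv D = some C := by
  unfold phiInv Function.partialInv
  have hex : ∃ a, phi a = some D := ⟨C, h⟩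
  rw [dif_pos hex]
  exact congrArg some (phi_injective (Classical.choose_spec hex) h)

/-! ### Removing and adding a letter in a split pair -/

/-- Take the last zero `t` of the walk up to `a`. The walk is positive from there to `a`, so it has
to step up at `t`, unless `t = a`, where nonnegativity puts `a` in `L` too. It cannot cross the
middle, where the height is zero. -/
theorem IsSplit.exists_start {L R : Column n} (h : IsSplit L R) {a : Letter n} (ha : a ∈ R) :
    ∃ t, t ≤ a ∧ (IsUnbarred t ↔ IsUnbarred a) ∧ t ∈ L ∧ (t = a ∨ t ∉ R) ∧
      height L R t.val = 0 ∧ ∀ y, t.val < y → y ≤ a.val → 0 < height L R y := by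
  have hn := a.isLt
  have hne : (Finset.univ.filter fun x : Letter n => x ≤ a ∧ height L R x.val = 0).Nonempty :=
    ⟨⟨0, by omega⟩, Finset.mem_filter.2
      ⟨Finset.mem_univ _, Fin.le_def.2 (Nat.zero_le _), height_zero L R⟩⟩
  obtain ⟨t, ht⟩ : ∃ t, Finset.max' _ hne = t := ⟨_, rfl⟩
  obtain ⟨hta, ht0⟩ := (Finset.mem_filter.1 (ht ▸ Finset.max'_mem _ hne)).2
  have hmax : ∀ x : Letter n, x ≤ a → height L R x.val = 0 → x ≤ t := fun x hx hx0 =>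
    ht ▸ Finset.le_max' _ _ (Finset.mem_filter.2 ⟨Finset.mem_univ x, hx, hx0⟩)
  have hpos : ∀ y, t.val < y → y ≤ a.val → 0 < height L R y := by
    intro y hty hya
    refine lt_of_le_of_ne (h.nonneg y) fun hy => ?_
    have := hmax ⟨y, by omega⟩ (Fin.le_def.2 hya) hy.symm
    rw [Fin.le_def] at this
    simp only at this
    omega
  rw [Fin.le_def] at hta
  have hhalf : IsUnbarred t ↔ IsUnbarred a := by
    unfold IsUnbarred
    refine ⟨fun ht => ?_, fun ha => by omega⟩
    by_contra hc
    have := hpos n ht (by omega)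
    rw [h.mid] at this
    omega
  have h1 := h.nonneg (t.val + 1)
  have h2 : t = a ∨ 0 < height L R (t.val + 1) := by
    by_cases hta' : t.val = a.val
    · exact Or.inl (Fin.ext hta')
    · exact Or.inr (hpos _ (Nat.lt_succ_self _) (by omega))
  have htL : t ∈ L := by
    by_contra hc
    unfold height at *
    rw [below_succ_of_notMem hc] at h1 h2
    rcases h2 with rfl | h2
    · rw [below_succ_of_mem ha] at h1
      omega
    · have := below_mono R (Nat.le_succ t.val)
      simp only [Nat.succ_eq_add_one] at this
      omega
  refine ⟨t, Fin.le_def.2 hta, hhalf, htL, h2.imp_right fun h2 htR => ?_, ht0, hpos⟩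
  unfold height at *
  rw [below_succ_of_mem htL, below_succ_of_mem htR] at h2
  omega

/-- Removing the letter `a` from the unbarred or barred part of the right column of a split
pair. -/
theorem IsSplit.exists_remove {L R : Column n} (h : IsSplit L R) {a : Letter n} (ha : a ∈ R) :
    ∃ t, t ≤ a ∧ (IsUnbarred t ↔ IsUnbarred a) ∧ t ∈ L ∧
      (∀ y, below ((insert (bar a) (R.erase a)).erase (bar t)) y = below R y -
        (if a.val < y then 1 else 0) + (if (bar a).val < y then 1 else 0) -
          if (bar t).val < y then 1 else 0) ∧
      (∀ x, t ≤ x → x ≤ a → x ∈ occ R) ∧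
      IsSplit (L.erase t) ((insert (bar a) (R.erase a)).erase (bar t)) := by
  obtain ⟨t, hta, hhalf, htL, htR, ht0, hpos⟩ := h.exists_start ha
  have hbaR := h.right a ha
  -- When `t = a` the letter `bar a` is inserted and erased again, and `a` simply leaves both
  -- columns.
  have hbt : t = a ∨ bar t ∈ R := by
    refine htR.imp_right fun htR => ?_
    have : t ∈ occ R := h.occ_eq ▸ mem_occ.2 (Or.inl htL)
    exact (mem_occ.1 this).resolve_left htR
  have hbta : bar t ≠ a := by
    rintro rfl
    rw [isUnbarred_bar] at hhalf
    tauto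
  have hbtm : bar t ∈ insert (bar a) (R.erase a) := by
    rcases hbt with rfl | hbt
    · exact Finset.mem_insert_self _ _
    · exact Finset.mem_insert_of_mem (Finset.mem_erase.2 ⟨hbta, hbt⟩)
  have hbR : ∀ y, below ((insert (bar a) (R.erase a)).erase (bar t)) y = below R y -
      (if a.val < y then 1 else 0) + (if (bar a).val < y then 1 else 0) -
        if (bar t).val < y then 1 else 0 := fun y => by
    rw [below_erase hbtm, below_insert (fun h => hbaR (Finset.mem_of_mem_erase h)),
      below_erase ha]
  have mR : ∀ x, x ∈ (insert (bar a) (R.erase a)).erase (bar t) ↔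
      x ≠ bar t ∧ (x = bar a ∨ x ≠ a ∧ x ∈ R) := fun x => by
    rw [Finset.mem_erase, Finset.mem_insert, Finset.mem_erase]
  have heq : ∀ x y : Letter n, bar x = y ↔ x = bar y := fun x y =>
    ⟨fun h => by rw [← h, bar_bar], fun h => by rw [h, bar_bar]⟩
  have hab : a ≠ bar a := by
    intro hc
    exact hbaR (hc ▸ ha)
  have nL : NoPair (L.erase t) := fun x hx hx' =>
    h.left x (Finset.mem_of_mem_erase hx) (Finset.mem_of_mem_erase hx')
  have hocc' : ∀ x, (x ∈ L ∨ bar x ∈ L) ↔ (x ∈ R ∨ bar x ∈ R) := fun x => by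
    rw [← mem_occ, h.occ_eq, mem_occ]
  have hL := h.left
  have hR := h.right
  have hbb := @bar_bar n
  unfold NoPair at hL hR
  have nR : NoPair ((insert (bar a) (R.erase a)).erase (bar t)) := by
    intro x
    rw [mR, mR]
    clear hhalf hbR hpos ht0 hocc' hL mR hbtm
    grind
  have hocc : occ (L.erase t) = occ ((insert (bar a) (R.erase a)).erase (bar t)) := by
    ext x
    have h1 := hocc' x
    rw [mem_occ, mem_occ, mR, mR, Finset.mem_erase, Finset.mem_erase]
    clear hhalf hbR hpos ht0 hocc' mR nL nR hbtm
    grind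
  -- The walk drops by one on `(t, a]` and on the mirror interval. It was positive on both, and they
  -- are disjoint because `t` and `a` lie in the same half.
  have hh : ∀ y, height (L.erase t) ((insert (bar a) (R.erase a)).erase (bar t)) y =
      height L R y - (if t.val < y ∧ y ≤ a.val then 1 else 0) -
        if (bar a).val < y ∧ y ≤ (bar t).val then 1 else 0 := by
    intro y
    have h1 := bar_val_add a
    have h2 := bar_val_add t
    rw [Fin.le_def] at hta
    unfold height
    rw [hbR, below_erase htL]
    split_ifs <;> omega
  have hpos' : ∀ y, (bar a).val < y → y ≤ (bar t).val → 0 < height L R y := by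
    intro y h1 h2
    have h3 := bar_val_add a
    have h4 := bar_val_add t
    rw [← height_symm_of_occ_eq h.left h.right h.occ_eq (by omega)]
    exact hpos _ (by omega) (by omega)
  have hsep : ∀ y, ¬ ((t.val < y ∧ y ≤ a.val) ∧ (bar a).val < y ∧ y ≤ (bar t).val) := by
    intro y
    have h3 := bar_val_add a
    have h4 := bar_val_add t
    unfold IsUnbarred at hhalf
    omega
  have hfree0 : ∀ x, x ∉ occ L →
      height (L.erase t) ((insert (bar a) (R.erase a)).erase (bar t)) x.val = 0 := by
    intro x hx
    have h0 := h.free x hx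
    have h1 := hpos x.val
    have h2 := hpos' x.val
    rw [hh, h0, if_neg fun hc => by have := h1 hc.1 hc.2; omega,
      if_neg fun hc => by have := h2 hc.1 hc.2; omega]
    rfl
  have ht0' : height (L.erase t) ((insert (bar a) (R.erase a)).erase (bar t)) t.val = 0 := by
    have h2 := hpos' t.val
    rw [hh, ht0, if_neg (by omega), if_neg fun hc => by have := h2 hc.1 hc.2; omega]
    rfl
  refine ⟨t, hta, hhalf, htL, hbR, fun x htx hxa => ?_, nL, nR, hocc, fun y => ?_, ?_,
    fun x hx => ?_⟩
  · by_contra hc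
    rw [← h.occ_eq] at hc
    rcases eq_or_lt_of_le htx with rfl | htx
    · exact hc (mem_occ.2 (Or.inl htL))
    · have := hpos x.val htx hxa
      rw [h.free x hc] at this
      omega
  · have h0 := h.nonneg y
    have h1 := hpos y
    have h2 := hpos' y
    have h3 := hsep y
    rw [hh]
    split_ifs <;> omega
  · have h0 := h.mid
    have h1 := hpos n
    have h2 := hpos' n
    rw [hh]
    split_ifs <;> omega
  · by_cases hxL : x ∈ occ L
    · have htt : t ∉ occ (L.erase t) := by
        have := h.left t htL
        simp [mem_occ, this]
      -- Only `t` and its bar become free, and `t` was chosen as a zero of the walk.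
      have hx' : x = t ∨ x = bar t := by
        rw [mem_occ, Finset.mem_erase, Finset.mem_erase, Ne, Ne, heq x] at hx
        rw [mem_occ] at hxL
        tauto
      rcases hx' with rfl | rfl
      · exact ht0'
      · rw [height_bar_of_notMem nL nR hocc htt]
        exact ht0'
    · exact hfree0 x hxL

/-- Adding the letter `a` to the unbarred or barred part of the left column of a split pair. -/
theorem IsSplit.add {L R : Column n} (h : IsSplit L R) {a x : Letter n} (ha : a ∉ L)
    (hx : IsNextFree R a x) (hhalf : IsUnbarred x ↔ IsUnbarred a) :
    (∀ y, below (insert a ((insert (bar x) L).erase (bar a))) y = below L y +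
        (if (bar x).val < y then 1 else 0) - (if (bar a).val < y then 1 else 0) +
          if a.val < y then 1 else 0) ∧
      IsSplit (insert a ((insert (bar x) L).erase (bar a))) (insert x R) := by
  obtain ⟨hax, hxR⟩ := hx.1
  have hgap : ∀ z, a ≤ z → z < x → z ∈ occ L := fun z haz hzx => by
    by_contra hc
    rw [h.occ_eq] at hc
    exact absurd (hx.2 ⟨haz, hc⟩) (not_le.2 hzx)
  have hxL : x ∉ occ L := h.occ_eq ▸ hxR
  rw [mem_occ] at hxR hxL
  have haa : x = a ∨ bar a ∈ L := by
    by_cases hxa : x = a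
    · exact Or.inl hxa
    · exact Or.inr ((mem_occ.1 (hgap a le_rfl (lt_of_le_of_ne hax (Ne.symm hxa)))).resolve_left ha)
  have hxba : x ≠ bar a := by
    rintro rfl
    rw [isUnbarred_bar] at hhalf
    tauto
  have hab : a ≠ bar a := fun hc => by
    have := isUnbarred_bar (x := a)
    rw [← hc] at this
    tauto
  have hbm : bar a ∈ insert (bar x) L := by
    rcases haa with rfl | haa
    · exact Finset.mem_insert_self _ _
    · exact Finset.mem_insert_of_mem haa
  have haI : a ∉ (insert (bar x) L).erase (bar a) := by
    rw [Finset.mem_erase, Finset.mem_insert]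
    rintro ⟨-, h | h⟩
    · exact hxba (by rw [h, bar_bar])
    · exact ha h
  have hbL : ∀ y, below (insert a ((insert (bar x) L).erase (bar a))) y = below L y +
      (if (bar x).val < y then 1 else 0) - (if (bar a).val < y then 1 else 0) +
        if a.val < y then 1 else 0 := fun y => by
    rw [below_insert haI, below_erase hbm, below_insert (by tauto)]
  refine ⟨hbL, ?_⟩
  have mL : ∀ z, z ∈ insert a ((insert (bar x) L).erase (bar a)) ↔
      z = a ∨ z ≠ bar a ∧ (z = bar x ∨ z ∈ L) := fun z => by
    rw [Finset.mem_insert, Finset.mem_erase, Finset.mem_insert]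
  have heq : ∀ x y : Letter n, bar x = y ↔ x = bar y := fun x y =>
    ⟨fun h => by rw [← h, bar_bar], fun h => by rw [h, bar_bar]⟩
  have hxx : x ≠ bar x := fun hc => by
    have := isUnbarred_bar (x := x)
    rw [← hc] at this
    tauto
  have hL := h.left
  have hR := h.right
  have hbb := @bar_bar n
  unfold NoPair at hL hR
  have nL : NoPair (insert a ((insert (bar x) L).erase (bar a))) := by
    intro z
    rw [mL, mL]
    clear hhalf hbL hR mL hgap hbm haI heq
    grind
  have nR : NoPair (insert x R) := by
    intro z
    rw [Finset.mem_insert, Finset.mem_insert]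
    clear hhalf hbL hL mL hgap hbm haI heq
    grind
  have hoccx : ∀ z, z ∈ occ (insert x R) ↔ z = x ∨ z = bar x ∨ z ∈ occ R := by
    intro z
    rw [mem_occ, mem_occ, Finset.mem_insert, Finset.mem_insert, heq z]
    tauto
  have hocc : occ (insert a ((insert (bar x) L).erase (bar a))) = occ (insert x R) := by
    ext z
    rw [hoccx, ← h.occ_eq, mem_occ, mem_occ, mL, mL]
    clear hhalf hbL mL hgap hbm haI heq hoccx nL nR
    grind
  have hle := Fin.le_def.1 hax
  have b1 := bar_val_add a
  have b2 := bar_val_add x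
  -- The walk gains one on `(a, x]` and on the mirror interval. No letter still free lies there,
  -- since `x` is the first free letter from `a` on.
  have hh : ∀ y, height (insert a ((insert (bar x) L).erase (bar a))) (insert x R) y =
      height L R y + (if a.val < y ∧ y ≤ x.val then 1 else 0) +
        if (bar x).val < y ∧ y ≤ (bar a).val then 1 else 0 := by
    intro y
    unfold height
    rw [hbL, below_insert (by tauto)]
    split_ifs <;> omega
  refine ⟨nL, nR, hocc, fun y => ?_, ?_, fun z hz => ?_⟩
  · have := h.nonneg y
    rw [hh]
    split_ifs <;> omega
  · rw [hh, h.mid]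
    unfold IsUnbarred at hhalf
    split_ifs <;> omega
  · rw [hocc, hoccx, not_or, not_or, ← h.occ_eq] at hz
    obtain ⟨hzx, hzx', hz⟩ := hz
    rw [hh, h.free z hz]
    have n1 : z.val ≠ x.val := fun h => hzx (Fin.ext h)
    have b3 := bar_val_add z
    rw [if_neg, if_neg]
    · rfl
    · rintro ⟨h1, h2⟩
      have := hgap (bar z) (Fin.le_def.2 (by omega)) (Fin.lt_def.2 (by omega))
      exact hz (bar_mem_occ.1 this)
    · rintro ⟨h1, h2⟩
      exact hz (hgap z (Fin.le_def.2 (by omega)) (Fin.lt_def.2 (by omega)))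

/-! ### The effect of a slide on the matching -/

theorem below_le_add (S : Column n) {s t : ℕ} (h : s ≤ t) : below S t ≤ below S s + (t - s) := by
  induction t, h using Nat.le_induction with
  | base => simp
  | succ t _ ih =>
    have := below_succ_le S t
    push_cast
    omega

theorem below_eq_add {S : Column n} {s t : ℕ} (h : s ≤ t) (ht : t ≤ 2 * n)
    (hS : ∀ z : Letter n, s ≤ z.val → z.val < t → z ∈ S) :
    below S t = below S s + (t - s) := by
  induction t, h using Nat.le_induction with
  | base => simp
  | succ t hst ih =>
    have h1 := ih (by omega) fun z hz hzt => hS z hz (by omega)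
    have h2 := below_succ_of_mem (hS ⟨t, by omega⟩ hst (Nat.lt_succ_self t))
    simp only at h2
    push_cast
    omega

theorem entries_eq_cons {S : Column n} {a : Letter n} (ha : a ∈ S) (hmin : ∀ b ∈ S, a ≤ b) :
    entries S = a :: entries (S.erase a) := by
  have := Finset.sort_insert (· ≤ ·) (s := S.erase a) (a := a)
    (fun b hb => hmin b (Finset.mem_of_mem_erase hb)) (Finset.notMem_erase a S)
  rwa [Finset.insert_erase ha] at this

/-- The effect of a slide on the unmatched letters: the smallest one disappears, and the others
lead to the same filling. -/
theorem unmatched_slide {A B A' B' E : Column n} {a x t : Letter n} (hA : NoPair A)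
    (hB : NoPair B) (hE : occ E = occ B) (haU : a ∈ unmatched A B)
    (hmin : ∀ b ∈ unmatched A B, a ≤ b) (hx : IsNextFree E a x)
    (hta : t ≤ a) (hta' : t.val < n ↔ a.val < n)
    (htocc : ∀ z, t ≤ z → z ≤ a → z ∈ occ A)
    (hA' : ∀ y, below A' y = below A y - (if a.val < y then 1 else 0) +
      (if (bar a).val < y then 1 else 0) - if (bar t).val < y then 1 else 0)
    (hB' : ∀ y, below B' y = below B y + (if (bar x).val < y then 1 else 0) -
      (if (bar a).val < y then 1 else 0) + if a.val < y then 1 else 0) :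
    (unmatched A' B').card + 1 = (unmatched A B).card ∧
      fillCells (entries ((unmatched A B).erase a)) (insert x E) =
        fillCells (entries (unmatched A' B')) (insert x E) := by
  have vt := bar_val_add t
  have va := bar_val_add a
  have vx := bar_val_add x
  have htlt := t.isLt
  have halt := a.isLt
  have hxlt := x.isLt
  have hax := Fin.le_def.1 hx.1.1
  rw [Fin.le_def] at hta
  -- The walk falls by two after `a`, up to a gain on `(bar a, bar t]` and a further loss on `(bar
  -- x, bar a]`.
  have hD : ∀ y, height A' B' y = height A B y - 2 * (if a.val < y then 1 else 0) +
      (if (bar a).val < y ∧ y ≤ (bar t).val then 1 else 0) -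
      if (bar x).val < y ∧ y ≤ (bar a).val then 1 else 0 := by
    intro y
    unfold height
    rw [hA', hB']
    split_ifs <;> omega
  have hlow := height_le_of_isLeast hmin haU
  have hup := mem_unmatched.1 haU
  have hcard := card_unmatched hmin haU
  have hnext : ∀ z, a ≤ z → z < x → z ∈ occ B := fun z haz hzx => by
    by_contra hc
    rw [← hE] at hc
    exact absurd (hx.2 ⟨haz, hc⟩) (not_le.2 hzx)
  -- `B` occupies all of `[a, x)`, so by symmetry the rises on `[a, 2n - y)` and on its mirror sum
  -- to at most zero; the first is positive because `a` is unmatched.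
  have hF1 : ∀ y, a.val < n → (bar x).val < y → y ≤ (bar a).val →
      height A B ((bar a).val + 1) + 1 ≤ height A B y := by
    intro y han hxy hya
    have h1 := height_symm hA hB (s := a.val) (t := 2 * n - y) (by omega) (by omega)
    rw [show 2 * n - (2 * n - y) = y by omega, show 2 * n - a.val = (bar a).val + 1 by omega] at h1
    have h2 := below_le_add (occ A) (show a.val ≤ 2 * n - y by omega)
    have h3 := below_eq_add (S := occ B) (show a.val ≤ 2 * n - y by omega) (by omega)
      fun z h1 h2 => hnext z (Fin.le_def.2 h1) (Fin.lt_def.2 (by omega))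
    have h4 := hup (2 * n - y) (by omega)
    omega
  -- Here `A` occupies the mirror window `[2n - y, a)`, so the two rises sum to the number of
  -- letters there that are free for `B`. The rise up to `a` is at most zero, since the walk is
  -- lowest at `a`.
  have hF2 : ∀ y, (bar a).val < y → y ≤ (bar t).val →
      below (occ B)ᶜ y - below (occ B)ᶜ ((bar a).val + 1) ≤
        height A B y - height A B ((bar a).val + 1) := by
    intro y hay hyt
    have h1 := height_symm hA hB (s := 2 * n - y) (t := a.val) (by omega) (by omega)
    have e1 : 2 * n - (2 * n - y) = y := by omega
    have e2 : 2 * n - a.val = (bar a).val + 1 := by omega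
    rw [e1, e2] at h1
    have h2 := below_eq_add (S := occ A) (show 2 * n - y ≤ a.val by omega) (by omega)
      fun z h1 h2 => htocc z (Fin.le_def.2 (by omega)) (Fin.le_def.2 (by omega))
    have h4 := hlow (2 * n - y)
    have h5 := below_occ hB (y := y) (by omega)
    have h6 := below_occ hB (y := 2 * n - y) (by omega)
    have h7 := below_occ hB (y := a.val) (by omega)
    have h8 := below_occ hB (y := 2 * n - a.val) (by omega)
    rw [e1] at h6
    rw [e2] at h7 h8
    rw [show 2 * n - ((bar a).val + 1) = a.val by omega] at h8
    rw [below_compl _ (by omega), below_compl _ (by omega)]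
    omega
  have hF3 : height A B ((bar a).val) - (if (bar x).val < (bar a).val then 1 else 0) ≤
      height A B ((bar a).val + 1) := by
    have h1 := below_mono A (Nat.le_succ (bar a).val)
    have h2 := below_succ_le B (bar a).val
    simp only [Nat.succ_eq_add_one] at h1
    unfold height
    split_ifs with hc
    · omega
    · have hxe : x = a := Fin.ext (by omega)
      have hnB : bar a ∉ B := fun hc => by
        have := hx.1.2
        rw [hE, mem_occ, hxe] at this
        exact this (Or.inr hc)
      have := below_succ_of_notMem hnB
      omega
  -- The minimum drops by one and the final height by two, so exactly one unmatched letter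
  -- disappears.
  have hDlow : ∀ y, height A B a.val - 1 ≤ height A' B' y := by
    intro y
    have h1 := hlow y
    have h2 := hup y
    have h3 := hF1 y
    have h4 := hup ((bar a).val + 1)
    rw [hD]
    split_ifs <;> omega
  have hDa : height A' B' (a.val + 1) ≤ height A B a.val - 1 := by
    have h1 := height_succ_le A B a.val
    rw [hD]
    split_ifs <;> omega
  have hDtop : height A' B' (2 * n) = height A B (2 * n) - 2 := by
    rw [hD]
    split_ifs <;> omega
  have hcard' : ((unmatched A' B').card : ℤ) + 1 = (unmatched A B).card := by
    obtain ⟨h1, z, -, -, h2⟩ := unmatched_isLeast A' B' (Nat.zero_le (2 * n))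
    rw [below_zero] at h1 h2
    have h3 := h1 (a.val + 1) (Nat.zero_le _)
    have h4 := hDlow z
    omega
  refine ⟨by exact_mod_cast hcard', ?_⟩
  have hbU : ∀ y, y ≤ a.val → below (unmatched A B) y = 0 := by
    intro y hy
    rw [below_eq_of_gap (Nat.zero_le _), below_zero]
    intro z hz hh
    have := Fin.le_def.1 (hmin z hz)
    omega
  have hbU' : ∀ y, y ≤ a.val → below (unmatched A' B') y = 0 := by
    intro y hy
    have h1 := (unmatched_isLeast A' B' (y := y) (by omega)).1 (a.val + 1) (by omega)
    have h2 := below_nonneg (unmatched A' B') y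
    omega
  have hcd := Finset.card_erase_of_mem haU
  have hpos := Finset.card_pos.2 ⟨a, haU⟩
  apply fillCells_congr
  · rw [length_entries, length_entries]
    omega
  · exact entries_pairwise _
  · exact entries_pairwise _
  · intro y
    rw [entries_toFinset, entries_toFinset]
    rcases le_total y (2 * n) with hy | hy
    · rw [below_erase haU]
      by_cases hay : a.val < y
      · obtain ⟨-, z, hz1, hz2, hz3⟩ := unmatched_isLeast A' B' hy
        have h1 := (unmatched_isLeast A B hy).1
        have h2 := h1 z hz1
        have h3 := hF1 z
        have h4 := h1 ((bar a).val + 1)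
        rw [if_pos hay]
        rw [hD z] at hz3
        split_ifs at hz3 <;> omega
      · rw [hbU y (by omega), hbU' y (by omega), if_neg hay]
        rfl
    · rw [below_card _ hy, below_card _ hy]
      omega
  · intro r hr hlt
    rw [entries_toFinset, entries_toFinset, below_erase haU] at hlt
    simp only [entries_toFinset, below_erase haU]
    have hrlt := r.isLt
    have hay : a.val < r.val + 1 := by
      by_contra hc
      rw [hbU _ (by omega), hbU' _ (by omega), if_neg hc] at hlt
      omega
    rw [if_pos hay] at hlt
    obtain ⟨-, z, hz1, hz2, hz3⟩ := unmatched_isLeast A B (y := r.val + 1) (by omega)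
    have hM' := (unmatched_isLeast A' B' (y := r.val + 1) (by omega)).1
    -- The counts can differ at `r` only if the old minimum beyond `r` is attained where the walk
    -- gained; this interval reaches beyond `a` only for unbarred `a`.
    have hz : (bar a).val < z ∧ z ≤ (bar t).val ∧ a.val < n := by
      have h1 := hM' z hz1
      rw [hD z] at h1
      split_ifs at h1 <;> omega
    have hFz := hF2 z hz.1 hz.2.1
    have hmono := below_mono (occ B)ᶜ (show (bar a).val + 1 ≤ z by omega)
    have har : (bar a).val < r.val + 1 := by
      by_contra hc
      have h1 := hM' (bar a).val (by omega)
      rw [hD (bar a).val] at h1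
      split_ifs at h1 hF3 <;> omega
    -- The window starts at `bar a`, which is occupied. The free letters after it number at most the
    -- rise of the walk (`hF2`), and this is at most the number of old unmatched letters in the
    -- window.
    refine ⟨(bar a).val, by omega, ?_⟩
    have hocc : bar a ∈ occ (insert x E) := by
      rw [bar_mem_occ]
      by_cases hxe : x = a
      · exact mem_occ.2 (Or.inl (by simp [hxe]))
      · refine occ_mono (Finset.subset_insert _ _) (hE ▸ hnext a le_rfl ?_)
        exact lt_of_le_of_ne hx.1.1 (Ne.symm hxe)
    have h1 := below_succ_of_notMem (S := (occ (insert x E))ᶜ) (a := bar a) (by simpa using hocc)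
    have hsub : (occ (insert x E))ᶜ ⊆ (occ B)ᶜ := by
      rw [← hE]
      exact Finset.compl_subset_compl.2 (occ_mono (Finset.subset_insert _ _))
    have h2 := below_sub_le_of_subset hsub (show (bar a).val + 1 ≤ r.val + 1 by omega)
    have h3 := below_mono (occ B)ᶜ hz1
    have h4 := (unmatched_isLeast A B (y := (bar a).val) (by omega)).1 ((bar a).val + 1) (by omega)
    rw [if_pos hay, if_pos (by omega)]
    omega

/-! ### Runs of the jeu de taquin -/

theorem IsSplit.card_eq {L R : Column n} (h : IsSplit L R) : L.card = R.card := by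
  have := h.total
  rw [height, below_card _ le_rfl, below_card _ le_rfl] at this
  omega

theorem IsSplit.card_merge {L R : Column n} (h : IsSplit L R) : (merge L R).card = R.card := by
  have h1 := h.mid
  rw [height, below, below] at h1
  have h2 : (merge L R).card =
      (L.filter fun x => ¬ IsUnbarred x).card + (R.filter fun x => IsUnbarred x).card :=
    Finset.card_union_of_disjoint (Finset.disjoint_left.2 fun x hx hx' =>
      (Finset.mem_filter.1 hx).2 (Finset.mem_filter.1 hx').2)
  have h3 := Finset.card_filter_add_card_filter_not (s := L) fun x => IsUnbarred x
  have h4 := h.card_eq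
  unfold IsUnbarred at *
  omega

/-- A stage of the symplectic jeu de taquin, with the columns in split form, with `m` unmatched
letters left, and such that filling these leads to `K`. -/
structure IsStage (S : SkewPair n) (L₁ R₁ L₂ R₂ K : Column n) (m : ℕ) : Prop where
  left_split : IsSplit L₁ R₁
  right_split : IsSplit L₂ R₂
  left_eq : S.left = merge L₁ R₁
  right_eq : S.right = merge L₂ R₂
  rightTop_eq : S.rightTop = 0
  card_unmatched : (unmatched R₁ L₂).card = m
  -- The bottoms of the two columns differ by `m`, as the right column starts in row `0`.
  card_eq : L₂.card + m = R₁.card + S.leftTop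
  fill : fillCells (entries (unmatched R₁ L₂)) R₂ = some K

theorem exists_smallest {S : Column n} (h : 0 < S.card) : ∃ a ∈ S, ∀ b ∈ S, a ≤ b :=
  ⟨_, Finset.min'_mem S (Finset.card_pos.1 h), fun _ => Finset.min'_le _ _⟩

/-- The shape puts `a` in row `below B a`. Below that row the letter `b` above the puncture exceeds
`a`, and since the walk stays above its level at `a`, the letter to the left is at most `b`: the
puncture climbs. In the row of `a` the letter above, if any, is smaller than `a`. -/
theorem slideFrom_eq {S : SkewPair n} {A B : Column n} {a : Letter n} (htop : S.rightTop = 0)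
    (hcard : B.card + (unmatched A B).card = A.card + S.leftTop)
    (ha : a ∈ unmatched A B) (hmin : ∀ b ∈ unmatched A B, a ≤ b) {r : ℕ}
    (hr : below B a.val ≤ r) (hrB : r ≤ B.card) :
    slideFrom S A B r = horizontalSlide S a := by
  have haA := unmatched_subset A B ha
  have haB := notMem_of_mem_unmatched ha
  have hc := SymplecticTableau.card_unmatched hmin ha
  have hpos := Finset.card_pos.2 ⟨a, ha⟩
  have hrow : below B a.val = below A a.val + S.leftTop := by
    rw [height, height, below_card _ le_rfl, below_card _ le_rfl] at hc
    omega
  have h0 := below_nonneg A a.val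
  have hα : ∀ s : ℕ, below B a.val = s → entryAt A S.leftTop s = some a := by
    intro s hs
    rw [entryAt, if_pos (by omega), getElem?_entries]
    exact ⟨haA, by omega⟩
  induction r with
  | zero => rw [slideFrom, hα 0 (by push_cast at hr; omega)]
  | succ r ih =>
    obtain ⟨b, hb⟩ : ∃ b, (entries B)[r]? = some b :=
      ⟨_, List.getElem?_eq_getElem (by rw [length_entries]; omega)⟩
    obtain ⟨hbB, hbr⟩ := getElem?_entries.1 hb
    have hbe : entryAt B S.rightTop r = some b := by
      rw [entryAt, if_pos (by omega), htop]
      exact hb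
    rcases hr.eq_or_lt with hr | hr
    · have hba : ¬ a ≤ b := fun hab => by
        have := below_mono B (Fin.le_def.1 hab)
        push_cast at hr
        omega
      rw [slideFrom, hbe, hα _ hr]
      simp only [if_neg hba]
    · push_cast at hr
      have hidx : r + 1 - S.leftTop < (entries A).length := by rw [length_entries]; omega
      obtain ⟨c, hcc⟩ : ∃ c, (entries A)[r + 1 - S.leftTop]? = some c :=
        ⟨_, List.getElem?_eq_getElem hidx⟩
      obtain ⟨hcA, hcr⟩ := getElem?_entries.1 hcc
      have hce : entryAt A S.leftTop (r + 1) = some c := by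
        rw [entryAt, if_pos (by omega)]
        exact hcc
      have hab : a.val < b.val := by
        by_contra hle
        have hne : a.val ≠ b.val := fun h => haB (Fin.ext h ▸ hbB)
        have := below_lt_of_mem hbB (show b.val < a.val by omega)
        omega
      have hcb : c ≤ b := by
        have h1 := mem_unmatched.1 ha (b.val + 1) (by omega)
        have h2 := below_succ_of_mem hbB
        unfold height at h1
        rw [Fin.le_def]
        by_contra hlt
        have h3 := below_mono A (show b.val + 1 ≤ c.val by omega)
        omega
      rw [slideFrom, hbe, hce]
      simp only [if_pos hcb]
      exact ih (by omega) (by omega)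

/-- If `a` is unbarred and nothing is free between `a` and the middle, `B` occupies that window. By
symmetry the walk cannot rise from `a` to `2n - a`, though `a` is unmatched. -/
theorem isUnbarred_of_isNextFree {A B E : Column n} (hA : NoPair A) (hB : NoPair B)
    (hE : occ E = occ B) {a x : Letter n} (ha : a ∈ unmatched A B) (hx : IsNextFree E a x) :
    IsUnbarred x ↔ IsUnbarred a := by
  have hax := Fin.le_def.1 hx.1.1
  unfold IsUnbarred
  refine ⟨fun h => by omega, fun han => ?_⟩
  by_contra hxn
  have h1 := height_symm hA hB (s := a.val) (t := n) (by omega) (by omega)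
  rw [show 2 * n - n = n by omega] at h1
  have h2 := below_le_add (occ A) han.le
  have h3 := below_eq_add (S := occ B) han.le (by omega) fun z hz hzn => by
    by_contra hc
    rw [← hE] at hc
    have := Fin.le_def.1 (hx.2 ⟨Fin.le_def.2 hz, hc⟩)
    omega
  have h4 := mem_unmatched.1 ha (2 * n - a.val) (by omega)
  omega

/-- Passing from `C` to `Φ(C)` exchanges `merge L R` and `merge R L`. In either case the merged
columns seen by the slide change only by `a`, because the exchanged letters fall in the hidden
halves. -/
theorem horizontalSlide_eq {S : SkewPair n} {L₁ R₁ L₂ R₂ L₁' R₁' L₂' R₂' : Column n}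
    {a x t : Letter n} (h₁ : IsSplit L₁ R₁) (h₂ : IsSplit L₂ R₂) (h₁' : IsSplit L₁' R₁')
    (h₂' : IsSplit L₂' R₂') (hl : S.left = merge L₁ R₁) (hr : S.right = merge L₂ R₂)
    (hxa : IsUnbarred x ↔ IsUnbarred a) (hta : IsUnbarred t ↔ IsUnbarred a)
    (eL₁ : L₁' = L₁.erase t) (eR₁ : R₁' = (insert (bar a) (R₁.erase a)).erase (bar t))
    (eL₂ : L₂' = insert a ((insert (bar x) L₂).erase (bar a))) (eR₂ : R₂' = insert x R₂) :
    horizontalSlide S a = some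
      { left := merge L₁' R₁', right := merge L₂' R₂',
        leftTop := S.leftTop + 1, rightTop := S.rightTop } := by
  have ua := isUnbarred_bar (x := a)
  have ux := isUnbarred_bar (x := x)
  have ut := isUnbarred_bar (x := t)
  have mL₁ : ∀ z, z ∈ L₁' ↔ z ≠ t ∧ z ∈ L₁ := fun z => by rw [eL₁, Finset.mem_erase]
  have mR₁ : ∀ z, z ∈ R₁' ↔ z ≠ bar t ∧ (z = bar a ∨ z ≠ a ∧ z ∈ R₁) := fun z => by
    rw [eR₁, Finset.mem_erase, Finset.mem_insert, Finset.mem_erase]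
  have mL₂ : ∀ z, z ∈ L₂' ↔ z = a ∨ z ≠ bar a ∧ (z = bar x ∨ z ∈ L₂) := fun z => by
    rw [eL₂, Finset.mem_insert, Finset.mem_erase, Finset.mem_insert]
  have mR₂ : ∀ z, z ∈ R₂' ↔ z = x ∨ z ∈ R₂ := fun z => by rw [eR₂, Finset.mem_insert]
  have hne : ∀ {z w : Letter n}, IsUnbarred z → ¬ IsUnbarred w → z ≠ w := fun h h' e =>
    h' (e ▸ h)
  rw [horizontalSlide, hl, hr]
  split_ifs with hu
  · have e1 : insert a (merge R₂ L₂) = merge R₂' L₂' := by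
      ext z
      rw [Finset.mem_insert, mem_merge, mem_merge, mL₂, mR₂]
      have hbx : ¬ IsUnbarred (bar x) := fun h => ux.1 h (hxa.2 hu)
      have hba : ¬ IsUnbarred (bar a) := fun h => ua.1 h hu
      by_cases hz : IsUnbarred z
      · simp [hz, hne hz hbx, hne hz hba]
      · simp [hz, (hne (hxa.2 hu) hz).symm, (hne hu hz).symm]
    have e2 : (merge L₁ R₁).erase a = merge L₁' R₁' := by
      ext z
      rw [Finset.mem_erase, mem_merge, mem_merge, mL₁, mR₁]
      have hbt : ¬ IsUnbarred (bar t) := fun h => ut.1 h (hta.2 hu)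
      have hba : ¬ IsUnbarred (bar a) := fun h => ua.1 h hu
      by_cases hz : IsUnbarred z
      · simp [hz, hne hz hbt, hne hz hba]
      · simp [hz, (hne (hta.2 hu) hz).symm, (hne hu hz).symm]
    rw [h₂.phi_merge, Option.bind_some, e1, phiInv_eq h₂'.phi_merge, e2, Option.map_some]
  · have e1 : insert a (merge L₂ R₂) = merge L₂' R₂' := by
      ext z
      rw [Finset.mem_insert, mem_merge, mem_merge, mL₂, mR₂]
      have hx : ¬ IsUnbarred x := fun h => hu (hxa.1 h)
      by_cases hz : IsUnbarred z
      · simp [hz, hne hz hx, hne hz hu]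
      · simp [hz, (hne (ux.2 hx) hz).symm, (hne (ua.2 hu) hz).symm]
    have e2 : (merge R₁ L₁).erase a = merge R₁' L₁' := by
      ext z
      rw [Finset.mem_erase, mem_merge, mem_merge, mL₁, mR₁]
      have ht : ¬ IsUnbarred t := fun h => hu (hta.1 h)
      by_cases hz : IsUnbarred z
      · simp [hz, hne hz ht, hne hz hu]
      · simp [hz, (hne (ut.2 ht) hz).symm, (hne (ua.2 hu) hz).symm]
    rw [h₁.phi_merge, Option.bind_some, e2, phiInv_eq h₁'.phi_merge, e1, Option.map_some]

/-- One run of the symplectic jeu de taquin fills one cell. -/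
theorem IsStage.reverseSlide_eq {S : SkewPair n} {L₁ R₁ L₂ R₂ K : Column n} {m : ℕ}
    (h : IsStage S L₁ R₁ L₂ R₂ K (m + 1)) :
    ∃ S' L₁' R₁' L₂' R₂', reverseSlide S = some S' ∧ S'.left.card + 1 = S.left.card ∧
      S'.right.card = S.right.card + 1 ∧ IsStage S' L₁' R₁' L₂' R₂' K m := by
  obtain ⟨h₁, h₂, hl, hr, htop, hm, hcard, hfill⟩ := h
  obtain ⟨a, haU, hmin⟩ := exists_smallest (show 0 < (unmatched R₁ L₂).card by omega)
  have haR := unmatched_subset _ _ haU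
  have haL := notMem_of_mem_unmatched haU
  rw [entries_eq_cons haU hmin] at hfill
  obtain ⟨x, hx⟩ := isNextFree_of_fillCells hfill
  rw [hx.fillCells_cons] at hfill
  have hxa := isUnbarred_of_isNextFree h₁.right h₂.left h₂.occ_eq.symm haU hx
  obtain ⟨t, hta, hta', htL, hbR, htocc, h₁'⟩ := h₁.exists_remove haR
  obtain ⟨hbL, h₂'⟩ := h₂.add haL hx hxa
  obtain ⟨hU, hf⟩ := unmatched_slide h₁.right h₂.left h₂.occ_eq.symm haU hmin hx hta hta'
    htocc hbR hbL
  rw [hf] at hfill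
  have hslide := horizontalSlide_eq h₁ h₂ h₁' h₂' hl hr hxa hta' rfl rfl rfl rfl
  have hcL := h₁.card_merge
  have hcR := h₂.card_merge
  have hcR' := h₂.card_eq
  have hcL' := h₁.card_eq
  have h1c := h₁'.card_merge
  have h2c := h₂'.card_merge
  have h1e := h₁'.card_eq
  have h2e := h₂'.card_eq
  rw [Finset.card_erase_of_mem htL] at h1e
  have htpos := Finset.card_pos.2 ⟨t, htL⟩
  have hxR : x ∉ R₂ := fun h => hx.1.2 (mem_occ.2 (Or.inl h))
  rw [Finset.card_insert_of_notMem hxR] at h2c h2e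
  have hrev : reverseSlide S = horizontalSlide S a := by
    rw [reverseSlide, hl, hr, if_pos (by omega), h₁.rightCol_merge, h₂.leftCol_merge,
      Option.bind_some, Option.bind_some, htop, Nat.zero_add, hcR, ← hcR',
      slideFrom_eq htop (by omega) haU hmin (below_le_card _ _) le_rfl]
  rw [hslide] at hrev
  refine ⟨_, _, _, _, _, hrev, ?_, ?_, ⟨h₁', h₂', rfl, rfl, htop, by omega, ?_, hfill⟩⟩
  · simp only [hl]
    omega
  · simp only [hr]
    omega
  · simp only
    omega

/-- The filled column `K` is the same at all stages; with no unmatched letter left it is the current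
right column. -/
theorem IsStage.slideUntil_eq {S : SkewPair n} {L₁ R₁ L₂ R₂ K : Column n} {m b a : ℕ}
    (h : IsStage S L₁ R₁ L₂ R₂ K m) (hb : S.left.card = b + m) (ha : S.right.card + m = a) :
    ∃ S' L, slideUntil b a m S = some S' ∧ S'.right = merge L K ∧ IsSplit L K := by
  induction m generalizing S L₁ R₁ L₂ R₂ with
  | zero =>
    have hK := h.fill
    rw [Finset.card_eq_zero.1 h.card_unmatched, entries, Finset.sort_empty, fillCells,
      Option.some.injEq] at hK
    subst hK
    exact ⟨S, L₂, by rw [slideUntil, if_pos ⟨hb, ha⟩], h.right_eq, h.right_split⟩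
  | succ m ih =>
    obtain ⟨S', L₁', R₁', L₂', R₂', hS', h1, h2, h'⟩ := h.reverseSlide_eq
    rw [slideUntil, if_neg (by omega), hS', Option.bind_some]
    exact ih h' (by omega) (by omega)

/-! ### Two columns, and induction on the tableau -/

/-- The two-column case: the direct way computes the right column of the column obtained by
swapping the lengths. -/
theorem directStep_eq_swapLengths {L₁ R₁ L₂ R₂ : Column n} (h₁ : IsSplit L₁ R₁)
    (h₂ : IsSplit L₂ R₂) (hle : ∀ y, below L₂ y ≤ below R₁ y) :
    ∃ K L S, directStep R₁ (merge L₂ R₂) = some K ∧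
      swapLengths (merge L₁ R₁) (merge L₂ R₂) = some S ∧ S.right = merge L K ∧ IsSplit L K ∧
      R₂ ⊆ K ∧ K.card = R₁.card := by
  obtain ⟨K, hK⟩ := exists_fillCells h₁.right h₂.left h₂.occ_eq.symm hle
  have hU : ((unmatched R₁ L₂).card : ℤ) = R₁.card - L₂.card := by
    obtain ⟨h1, z, -, -, h2⟩ := unmatched_isLeast R₁ L₂ (Nat.zero_le (2 * n))
    have h3 := h1 0 le_rfl
    have h4 := hle z
    rw [below_zero] at h2 h3
    rw [height_zero] at h3
    unfold height at h2 h3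
    rw [below_card _ le_rfl, below_card _ le_rfl] at h2 h3
    omega
  have hcL := h₁.card_merge
  have hcR := h₂.card_merge
  have hcR' := h₂.card_eq
  obtain ⟨hsub, hcard⟩ := fillCells_subset_card hK
  rw [length_entries] at hcard
  have hst : IsStage { left := merge L₁ R₁, right := merge L₂ R₂, leftTop := 0, rightTop := 0 }
      L₁ R₁ L₂ R₂ K ((merge L₁ R₁).card - (merge L₂ R₂).card) :=
    ⟨h₁, h₂, rfl, rfl, rfl, by omega, by simp only; omega, hK⟩
  obtain ⟨S, L, hS, hright, hsplit⟩ := hst.slideUntil_eq (b := (merge L₂ R₂).card)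
    (a := (merge L₁ R₁).card) (by simp only; omega) (by simp only; omega)
  refine ⟨K, L, S, ?_, hS, hright, hsplit, hsub, by omega⟩
  rw [directStep, h₂.leftCol_merge, h₂.rightCol_merge, Option.bind_some, Option.bind_some, hK]

/-- The current column is an arbitrary split pair, because the columns `D_j` need not belong to the
tableau. All it must do is dominate the next left column, which persists because each filled column
contains the right column it was built from. -/
theorem directLoop_eq_rightKeyLoop {T : List (Column n)} {L R : Column n} (h : IsSplit L R)
    {S : List (Column n)} (hS : splitForm T = some S) (hchain : S.IsChain RowLE)
    (hle : ∀ D ∈ S.head?, ∀ y, below D y ≤ below R y) :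
    ∃ K, directLoop R T = some K ∧ rightKeyLoop (merge L R) T = some K ∧ K.card = R.card ∧
      (T = [] → K = R) ∧
      ∀ hne : T ≠ [], ∃ R', rightCol (T.getLast hne) = some R' ∧ R' ⊆ K := by
  induction T generalizing L R S with
  | nil => exact ⟨R, rfl, h.rightCol_merge, rfl, fun _ => rfl, fun hne => absurd rfl hne⟩
  | cons D T ih =>
    rw [splitForm] at hS
    obtain ⟨L₂, hL₂, hS⟩ := Option.bind_eq_some_iff.1 hS
    obtain ⟨R₂, hR₂, hS⟩ := Option.bind_eq_some_iff.1 hS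
    obtain ⟨S', hS', rfl⟩ := Option.map_eq_some_iff.1 hS
    obtain ⟨R₂', h₂, rfl⟩ := exists_isSplit hL₂
    rw [h₂.rightCol_merge, Option.some.injEq] at hR₂
    subst hR₂
    obtain ⟨K, L', P, hstep, hswap, hP, hK, hsub, hcard⟩ :=
      directStep_eq_swapLengths h h₂ (hle L₂ rfl)
    have hchain' := hchain.tail.tail
    obtain ⟨K', hd, hk, hc, hnil, hlast⟩ := ih hK hS' hchain' fun D hD y => by
      obtain _ | ⟨D', S'⟩ := S'
      · simp at hD
      · simp only [List.head?_cons, Option.mem_def, Option.some.injEq] at hD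
        subst hD
        have hrow := (List.isChain_cons_cons.1 hchain.tail).1
        exact (hrow.below_le y).trans (below_subset hsub y)
    refine ⟨K', ?_, ?_, hc.trans hcard, fun h => absurd h (List.cons_ne_nil _ _), fun hne => ?_⟩
    · rw [directLoop, hstep, Option.bind_some, hd]
    · rw [rightKeyLoop, hswap, Option.bind_some, hP, hk]
    · by_cases hT : T = []
      · subst hT
        exact ⟨R₂', h₂.rightCol_merge, hnil rfl ▸ hsub⟩
      · rw [List.getLast_cons hT]
        exact hlast hT

end SymplecticTableau

theorem theorem5p1 (n : ℕ) (T : List (SymplecticTableau.Column n)) (hne : T ≠ [])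
    (hT : SymplecticTableau.IsStraightKN T) :
    ∃ K R : SymplecticTableau.Column n,
      SymplecticTableau.directWay T = some K ∧
      SymplecticTableau.rightCol (T.getLast hne) = some R ∧ R ⊆ K ∧
      K.card = (T.head hne).card ∧
      SymplecticTableau.rightKeyFirst T = some K := by
  open SymplecticTableau in
  obtain ⟨-, -, S, hS, hchain⟩ := hT
  obtain _ | ⟨C, T⟩ := T
  · exact absurd rfl hne
  rw [splitForm] at hS
  obtain ⟨L, hL, hS⟩ := Option.bind_eq_some_iff.1 hS
  obtain ⟨R, hR, hS⟩ := Option.bind_eq_some_iff.1 hS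
  obtain ⟨S', hS', rfl⟩ := Option.map_eq_some_iff.1 hS
  obtain ⟨R', h, rfl⟩ := exists_isSplit hL
  rw [h.rightCol_merge, Option.some.injEq] at hR
  subst hR
  have hchain' : (L :: R' :: S').IsChain RowLE := hchain
  obtain ⟨K, hd, hk, hc, hnil, hlast⟩ := directLoop_eq_rightKeyLoop h hS' hchain'.tail.tail
    fun D hD y => by
      obtain _ | ⟨D', S'⟩ := S'
      · simp at hD
      · simp only [List.head?_cons, Option.mem_def, Option.some.injEq] at hD
        subst hD
        exact (List.isChain_cons_cons.1 hchain'.tail).1.below_le y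
  obtain ⟨R₂, hR₂, hsub⟩ : ∃ R₂, rightCol ((merge L R' :: T).getLast hne) = some R₂ ∧ R₂ ⊆ K := by
    by_cases hT : T = []
    · subst hT
      exact ⟨R', h.rightCol_merge, (hnil rfl).ge⟩
    · rw [List.getLast_cons hT]
      exact hlast hT
  refine ⟨K, R₂, ?_, hR₂, hsub, ?_, hk⟩
  · rw [directWay, h.rightCol_merge, Option.bind_some, hd]
  · rw [List.head_cons, h.card_merge, hc]
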